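/- Let $n\ge 4$, let $C_n$ be the cycle with vertex set $\{0,1,\dots,n-1\}$, in which $i$ and $i+1$ (mod $n$) are adjacent, and let $M$ be the adjacency matrix, the Laplacian matrix or the signless Laplacian matrix of $C_n$. Put $U(t)=e^{-\mathrm{i}tM}$. For distinct vertices $a,b$ and $s\in\mathbb{R}\setminus\{0\}$, the $s$-pair state $\mathbf e_a+s\mathbf e_b$ is understood to be normalized by the factor $1/\sqrt{1+s^2}$; two unit vectors that differ by a complex factor of modulus one represent the same state. Perfect $s$-pair state transfer occurs from $\mathbf u=\mathbf e_a+s\mathbf e_b$ to a different $s$-pair state $\boldsymbol\mu=\mathbf e_\alpha+s\mathbf e_\beta$ (with $\alpha\ne\beta$) at time $\tau\in\mathbb{R}$ if $U(\tau)\mathbf u=\eta\boldsymbol\mu$ for some complex number $\eta$ with $|\eta|=1$; the minimum time is the least such $\tau>0$. Theorem. Let $b$ be an integer with $1\le b\le n/2$ and let $s\in\mathbb{R}\setminus\{0\}$. Perfect $s$-pair state transfer from the initial state $\mathbf e_0+s\mathbf e_b$ to a different $s$-pair state occurs in $C_n$ (relative to $M$) if and only if one of the following holds; in each case the final state is the one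 listed (and no other), and the transfer has the minimum time listed. 1. $n=4$: from $\mathbf e_0+s\mathbf e_1$ to $\mathbf e_2+s\mathbf e_3$, minimum time $\frac{\pi}{2}$, for every $s\in\mathbb{R}\setminus\{0\}$. 2. $n=4$: from $\mathbf e_0+s\mathbf e_2$ to $\mathbf e_2+s\mathbf e_0$, minimum time $\frac{\pi}{2}$, for every $s\in\mathbb{R}\setminus\{-1,0,1\}$. 3. $n=4$: from $\mathbf e_0+\mathbf e_2$ to $\mathbf e_1+\mathbf e_3$, minimum time $\frac{\pi}{4}$. 4. $n=6$: from $\mathbf e_0-\mathbf e_2$ to $\mathbf e_3-\mathbf e_5$, minimum time $\frac{\pi}{2}$. 5. $n=6$: from $\mathbf e_0+2\mathbf e_2$ to $\mathbf e_0+2\mathbf e_4$, minimum time $\pi$. 6. $n=6$: from $\mathbf e_0+\frac12\mathbf e_2$ to $\mathbf e_4+\frac12\mathbf e_2$, minimum time $\pi$. 7. $n=8$: from $\mathbf e_0-\mathbf e_2$ to $\mathbf e_4-\mathbf e_6$, minimum time $\frac{\pi}{\sqrt2}$. 8. $n=8$: from $\mathbf e_0+\mathbf e_4$ to $\mathbf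 e_2+\mathbf e_6$, minimum time $\frac{\pi}{2}$. -/

import Mathlib

open scoped Matrix

/-- The signless Laplacian matrix `D + A` of a finite graph. -/
def signlessLapMatrix {V : Type*} [Fintype V] [DecidableEq V]
    (G : SimpleGraph V) [DecidableRel G.Adj] : Matrix V V ℝ :=
  G.degMatrix ℝ + G.adjMatrix ℝ

/-- The transition matrix `U(t) = exp(-i t M)` of the continuous quantum walk with real
Hamiltonian `M`. -/
noncomputable def transitionMatrix {V : Type*} [Fintype V] [DecidableEq V]
    (M : Matrix V V ℝ) (t : ℝ) : Matrix V V ℂ :=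
  NormedSpace.exp ((-(Complex.I * (t : ℂ))) • M.map (fun x : ℝ => (x : ℂ)))

/-- The unit vector `(e_a + s e_b) / √(1 + |s|²)`. It is an `s`-pair state when `a ≠ b` and
`s ≠ 0`. -/
noncomputable def pairState {V : Type*} [DecidableEq V] (a b : V) (s : ℂ) : V → ℂ :=
  (((Real.sqrt (1 + ‖s‖ ^ 2))⁻¹ : ℝ) : ℂ) •
    ((Pi.single a 1 : V → ℂ) + s • (Pi.single b 1 : V → ℂ))

/-- Two vectors that differ by a phase factor represent the same quantum state. -/
def SameState {V : Type*} (u v : V → ℂ) : Prop :=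
  ∃ η : ℂ, ‖η‖ = 1 ∧ u = η • v

/-- `U(t) u = η v` for some phase factor `η`. -/
def StateTransferAt {V : Type*} [Fintype V] [DecidableEq V]
    (M : Matrix V V ℝ) (u v : V → ℂ) (t : ℝ) : Prop :=
  ∃ η : ℂ, ‖η‖ = 1 ∧ transitionMatrix M t *ᵥ u = η • v

/-- Perfect state transfer between two distinct states (the case of equal states is
periodicity). -/
def PerfectStateTransfer {V : Type*} [Fintype V] [DecidableEq V]
    (M : Matrix V V ℝ) (u v : V → ℂ) : Prop :=
  ¬ SameState u v ∧ ∃ t : ℝ, StateTransferAt M u v t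

/-- `τ` is the least positive time at which state transfer from `u` to `v` occurs. -/
def IsMinTransferTime {V : Type*} [Fintype V] [DecidableEq V]
    (M : Matrix V V ℝ) (u v : V → ℂ) (τ : ℝ) : Prop :=
  IsLeast {t : ℝ | 0 < t ∧ StateTransferAt M u v t} τ

/-- The eight families: in `C_n`, the initial state `e_0 + s e_b`, the final state
`e_α + s e_β` and the time `τ`. -/
def CycleTransferList (n b : ℕ) (s : ℝ) (α β : ℕ) (τ : ℝ) : Prop :=
  (n = 4 ∧ b = 1 ∧ s ≠ 0 ∧ α = 2 ∧ β = 3 ∧ τ = Real.pi / 2) ∨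
  (n = 4 ∧ b = 2 ∧ s ≠ -1 ∧ s ≠ 0 ∧ s ≠ 1 ∧ α = 2 ∧ β = 0 ∧ τ = Real.pi / 2) ∨
  (n = 4 ∧ b = 2 ∧ s = 1 ∧ α = 1 ∧ β = 3 ∧ τ = Real.pi / 4) ∨
  (n = 6 ∧ b = 2 ∧ s = -1 ∧ α = 3 ∧ β = 5 ∧ τ = Real.pi / 2) ∨
  (n = 6 ∧ b = 2 ∧ s = 2 ∧ α = 0 ∧ β = 4 ∧ τ = Real.pi) ∨
  (n = 6 ∧ b = 2 ∧ s = 1 / 2 ∧ α = 4 ∧ β = 2 ∧ τ = Real.pi) ∨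
  (n = 8 ∧ b = 2 ∧ s = -1 ∧ α = 4 ∧ β = 6 ∧ τ = Real.pi / Real.sqrt 2) ∨
  (n = 8 ∧ b = 4 ∧ s = 1 ∧ α = 2 ∧ β = 6 ∧ τ = Real.pi / 2)

/-! The cycle is 2-regular, so each of the three matrices is a scalar plus `A` or `-A`. The scalar
only contributes a global phase and the sign only reverses time. The characters `χ_j` of ℤ/n
diagonalise `A`, with eigenvalues `θ_j = 2 cos (2πj/n)`. Writing `f_j` and `g_j` for the transforms
of `e_0 + s e_b` and `e_α + s e_β`, transfer at time `t` means `exp(-i t θ_j) f_j = η g_j` for all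
`j` (`stateTransferAt_cycle_iff`).

Final states. Since `θ_{-j} = θ_j` and `χ_{-j}` is the conjugate of `χ_j`, multiplying the equation
at `j` by the conjugate of the one at `-j` eliminates time and leaves `f_j² = g_j²`. Hence `e_0 + s
e_b` and `e_α + s e_β` have equal squares in the group algebra. Equal moduli give in addition `β - α
= ±b`. Comparing coefficients leaves a short list of candidates (`CycleTransferAt.final_state`).

Size of `n`. On the support of `f` the numbers `t θ_j` agree modulo `π`, so ratios of eigenvalue
differences are rational. If 0, 1, 2 lie in the support, the ratio `(θ_0 - θ_2)/(θ_0 - θ_1) = 2 +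
θ_1` is rational and Niven's theorem gives `n = 4` or `n = 6`. Characters can drop out of the
support only if `s = ±1`. Other ratios are used then, and `n = 8` and `n = 12` become possible.

What remains is finite. Phases are computed for the listed transfers and shown contradictory for the
other candidates. Each minimum time is `π` divided by the gap between two eigenvalues whose
components must acquire a relative sign (`CycleTransferAt.pi_le`). -/

/-- The character `a ↦ exp (2πi j a / n)` of `ℤ/n`. -/
noncomputable def cycleChar (n : ℕ) (j : ℤ) (a : Fin n) : ℂ :=
  Complex.exp ((2 * Real.pi * j * (a : ℕ) / n : ℝ) * Complex.I)

/-- The eigenvalue `2 cos (2π j / n)` of the adjacency matrix of the `n`-cycle. -/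
noncomputable def cycleEig (n : ℕ) (j : ℤ) : ℝ := 2 * Real.cos (2 * Real.pi * j / n)

/-! ### Characters of ℤ/n -/

section Characters

variable {n : ℕ}

lemma cycleChar_zero [NeZero n] (j : ℤ) : cycleChar n j 0 = 1 := by simp [cycleChar]

lemma cycleChar_add [NeZero n] (j : ℤ) (a b : Fin n) :
    cycleChar n j (a + b) = cycleChar n j a * cycleChar n j b := by
  have hn : (n : ℂ) ≠ 0 := by exact_mod_cast NeZero.ne n
  unfold cycleChar
  rw [← Complex.exp_add, Complex.exp_eq_exp_iff_exists_int, Fin.val_add]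
  have h := Nat.mod_add_div ((a : ℕ) + b) n
  have h' : ((((a : ℕ) + b) % n : ℕ) : ℂ) = (a : ℕ) + (b : ℕ) - n * ((((a : ℕ) + b) / n : ℕ) : ℂ) := by
    rw [eq_sub_iff_add_eq]; exact_mod_cast h
  refine ⟨-(j * (((a : ℕ) + b) / n : ℕ)), ?_⟩
  rw [Complex.ofReal_div, Complex.ofReal_mul, Complex.ofReal_natCast, h']
  generalize ((((a : ℕ) + b) / n : ℕ)) = q
  push_cast
  field_simp
  ring

lemma cycleChar_mul_index (j k : ℤ) (a : Fin n) :
    cycleChar n (j * k) a = cycleChar n j a ^ k := by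
  unfold cycleChar
  rw [← Complex.exp_int_mul]
  congr 1
  push_cast
  ring

lemma cycleChar_two_mul [NeZero n] (j : ℤ) (a : Fin n) : cycleChar n (2 * j) a = cycleChar n j (a + a) := by
  rw [mul_comm, cycleChar_mul_index, cycleChar_add, ← sq]; norm_cast

lemma cycleChar_neg_index (j : ℤ) (a : Fin n) :
    cycleChar n (-j) a = (starRingEnd ℂ) (cycleChar n j a) := by
  unfold cycleChar
  rw [← Complex.exp_conj]
  congr 1
  simp only [map_mul, Complex.conj_I, Complex.conj_ofReal]
  push_cast
  ring

lemma cycleChar_re (j : ℤ) (a : Fin n) :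
    (cycleChar n j a).re = Real.cos (2 * Real.pi * j * (a : ℕ) / n) := by
  unfold cycleChar
  rw [Complex.exp_ofReal_mul_I_re]

lemma norm_cycleChar (j : ℤ) (a : Fin n) : ‖cycleChar n j a‖ = 1 := by
  unfold cycleChar
  rw [Complex.norm_exp_ofReal_mul_I]

lemma cycleChar_neg [NeZero n] (j : ℤ) (a : Fin n) :
    cycleChar n j (-a) = (starRingEnd ℂ) (cycleChar n j a) := by
  have h : cycleChar n j (-a) * cycleChar n j a = 1 := by
    rw [← cycleChar_add, neg_add_cancel, cycleChar_zero]
  have h2 : (starRingEnd ℂ) (cycleChar n j a) * cycleChar n j a = 1 := by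
    rw [mul_comm, Complex.mul_conj, Complex.normSq_eq_norm_sq, norm_cycleChar]; simp
  exact mul_right_cancel₀ (norm_ne_zero_iff.mp (by rw [norm_cycleChar]; exact one_ne_zero))
    (h.trans h2.symm)

lemma cycleEig_neg (j : ℤ) : cycleEig n (-j) = cycleEig n j := by
  unfold cycleEig
  rw [← Real.cos_neg]
  congr 2
  push_cast
  ring

/-- A vector that is orthogonal to all characters vanishes. -/
lemma eq_zero_of_forall_sum_cycleChar [NeZero n] (v : Fin n → ℂ)
    (h : ∀ j : Fin n, ∑ a, cycleChar n (j : ℕ) a * v a = 0) : v = 0 := by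
  have hn : n ≠ 0 := NeZero.ne n
  have hω := Complex.isPrimitiveRoot_exp n hn
  -- A Vandermonde system whose nodes are the distinct powers of a primitive root.
  refine Matrix.eq_zero_of_forall_index_sum_pow_mul_eq_zero
    (f := fun j : Fin n => Complex.exp (2 * Real.pi * Complex.I / n) ^ (j : ℕ)) ?_ ?_
  · intro i j hij
    exact Fin.ext (hω.pow_inj i.2 j.2 hij)
  · intro j
    rw [← h j]
    refine Finset.sum_congr rfl fun a _ => ?_
    congr 1
    rw [← pow_mul, ← Complex.exp_nat_mul, cycleChar]
    congr 1
    push_cast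
    ring

lemma cycleChar_one_add_conj [NeZero n] (hn : 2 ≤ n) (j : ℤ) :
    cycleChar n j 1 + (starRingEnd ℂ) (cycleChar n j 1) = cycleEig n j := by
  rw [Complex.add_conj, cycleChar_re, cycleEig, Fin.coe_ofNat_eq_mod, Nat.mod_eq_of_lt hn]
  simp

end Characters

/-! ### Spectrum of the cycle and the action of `U(t)` on characters -/

section Spectrum

variable {n : ℕ}

/-- The map `B ↦ v ᵥ* B` is additive and continuous, so it passes through the exponential series
term by term. Left eigenvectors are used because states are later paired with characters from the
left. -/
lemma Matrix.vecMul_exp_of_vecMul_eq_smul {m : Type*} [Fintype m] [DecidableEq m]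
    (A : Matrix m m ℂ) (v : m → ℂ) (c : ℂ) (h : v ᵥ* A = c • v) :
    v ᵥ* NormedSpace.exp A = Complex.exp c • v := by
  have hpow : ∀ k : ℕ, v ᵥ* A ^ k = c ^ k • v := by
    intro k
    induction k with
    | zero => simp
    | succ k ih => rw [pow_succ, ← Matrix.vecMul_vecMul, ih, Matrix.smul_vecMul, h, smul_smul, pow_succ]
  have h1 : HasSum (fun k : ℕ => ((k.factorial : ℂ)⁻¹) • A ^ k) (NormedSpace.exp A) := by
    open scoped Norms.Operator in exact NormedSpace.exp_series_hasSum_exp' (𝕂 := ℂ) A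
  let φ : Matrix m m ℂ →+ (m → ℂ) :=
    { toFun := fun B => v ᵥ* B, map_zero' := Matrix.vecMul_zero v,
      map_add' := fun B C => Matrix.vecMul_add B C v }
  have hφ : Continuous φ := by
    change Continuous fun B : Matrix m m ℂ => v ᵥ* B
    fun_prop
  have h2 := h1.map φ hφ
  have h3 : HasSum (fun k : ℕ => ((k.factorial : ℂ)⁻¹) • c ^ k) (NormedSpace.exp c) :=
    NormedSpace.exp_series_hasSum_exp' (𝕂 := ℂ) c
  have h4 := h3.smul_const v
  rw [← Complex.exp_eq_exp_ℂ] at h4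
  refine h2.unique (h4.congr_fun ?_)
  intro k
  change v ᵥ* (((k.factorial : ℂ)⁻¹) • A ^ k) = _
  rw [Matrix.vecMul_smul, hpow, smul_smul, smul_eq_mul]

lemma adjMatrix_cycleGraph_mulVec [NeZero n] (hn : 3 ≤ n) (v : Fin n → ℂ) (a : Fin n) :
    ((SimpleGraph.cycleGraph n).adjMatrix ℂ *ᵥ v) a = v (a - 1) + v (a + 1) := by
  obtain ⟨m, rfl⟩ : ∃ m, n = m + 3 := ⟨n - 3, by omega⟩
  rw [SimpleGraph.adjMatrix_mulVec_apply, SimpleGraph.cycleGraph_neighborFinset,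
    Finset.sum_pair]
  -- The two neighbours of `a` differ because `2 ≠ 0` in ℤ/n for `n ≥ 3`.
  intro h
  have h2 : (1 : Fin (m + 3)) + 1 = 0 := by
    have := congrArg (fun x => x - a + 1) h
    simpa [sub_eq_add_neg, add_comm, add_left_comm, add_assoc] using this.symm
  have := congrArg Fin.val h2
  simp [Fin.val_add, Nat.mod_eq_of_lt (show 2 < m + 3 by omega)] at this

lemma adjMatrix_vecMul_cycleChar [NeZero n] (hn : 3 ≤ n) (j : ℤ) :
    cycleChar n j ᵥ* (SimpleGraph.cycleGraph n).adjMatrix ℂ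
      = (cycleEig n j : ℂ) • cycleChar n j := by
  ext a
  rw [← Matrix.mulVec_transpose, SimpleGraph.transpose_adjMatrix, adjMatrix_cycleGraph_mulVec hn,
    sub_eq_add_neg, cycleChar_add, cycleChar_add, cycleChar_neg, Pi.smul_apply, smul_eq_mul,
    ← cycleChar_one_add_conj (by omega)]
  ring

lemma degMatrix_cycleGraph (hn : 3 ≤ n) :
    (SimpleGraph.cycleGraph n).degMatrix ℝ = (2 : ℝ) • 1 := by
  obtain ⟨m, rfl⟩ : ∃ m, n = m + 3 := ⟨n - 3, by omega⟩
  ext a b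
  simp [SimpleGraph.degMatrix, Matrix.diagonal_apply, Matrix.one_apply, SimpleGraph.cycleGraph_degree_three_le]

lemma map_adjMatrix_ofReal (G : SimpleGraph (Fin n)) [DecidableRel G.Adj] :
    (G.adjMatrix ℝ).map (fun x : ℝ => (x : ℂ)) = G.adjMatrix ℂ := by
  ext a b
  simp only [Matrix.map_apply, SimpleGraph.adjMatrix_apply]
  split_ifs <;> simp

/-- The action of `U(t)` in the character basis, for `M = x + y A`. -/
lemma cycleChar_dotProduct_transitionMatrix [NeZero n] (hn : 3 ≤ n) (x y t : ℝ) (j : ℤ) (v : Fin n → ℂ) :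
    cycleChar n j ⬝ᵥ (transitionMatrix
      (x • (1 : Matrix (Fin n) (Fin n) ℝ) + y • (SimpleGraph.cycleGraph n).adjMatrix ℝ) t *ᵥ v)
      = Complex.exp (-(Complex.I * t) * (x + y * cycleEig n j)) * (cycleChar n j ⬝ᵥ v) := by
  rw [Matrix.dotProduct_mulVec, transitionMatrix, Matrix.vecMul_exp_of_vecMul_eq_smul, smul_dotProduct, smul_eq_mul]
  rw [Matrix.vecMul_smul, mul_smul]
  congr 1
  have : (x • (1 : Matrix (Fin n) (Fin n) ℝ) + y • (SimpleGraph.cycleGraph n).adjMatrix ℝ).map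
      (fun x : ℝ => (x : ℂ)) = (x : ℂ) • (1 : Matrix (Fin n) (Fin n) ℂ) +
        (y : ℂ) • (SimpleGraph.cycleGraph n).adjMatrix ℂ := by
    rw [← map_adjMatrix_ofReal]
    ext a b
    by_cases h : a = b
    · simp [h]
    · simp only [Matrix.map_apply, Matrix.add_apply, Matrix.smul_apply, Matrix.one_apply, h,
        SimpleGraph.adjMatrix_apply]
      split_ifs <;> simp
  rw [this, Matrix.vecMul_add, Matrix.vecMul_smul, Matrix.vecMul_smul, Matrix.vecMul_one,
    adjMatrix_vecMul_cycleChar hn, add_smul, mul_smul]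

end Spectrum

/-! ### Transfer in the character basis, uniformly in the three matrices -/

section Transfer

variable {n : ℕ} [NeZero n]

/-- The transfer condition for the adjacency matrix of the `n`-cycle in the character basis. -/
def CycleTransferAt (n : ℕ) (a b α β : Fin n) (s t : ℝ) : Prop :=
  ∃ η : ℂ, ‖η‖ = 1 ∧ ∀ j : ℤ,
    Complex.exp (-(Complex.I * t) * cycleEig n j) * (cycleChar n j a + s * cycleChar n j b)
      = η * (cycleChar n j α + s * cycleChar n j β)

lemma norm_exp_neg_I_mul (t x : ℝ) : ‖Complex.exp (-(Complex.I * t) * x)‖ = 1 := by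
  rw [show -(Complex.I * t) * x = ((-(t * x) : ℝ) : ℂ) * Complex.I by push_cast; ring,
    Complex.norm_exp_ofReal_mul_I]

lemma pairState_factor_ne_zero (s : ℝ) :
    ((((Real.sqrt (1 + ‖(s : ℂ)‖ ^ 2))⁻¹ : ℝ)) : ℂ) ≠ 0 := by
  have : 0 < Real.sqrt (1 + ‖(s : ℂ)‖ ^ 2) := Real.sqrt_pos.mpr (by positivity)
  exact_mod_cast (inv_pos.mpr this).ne'

omit [NeZero n] in
lemma cycleChar_dotProduct_pairState (j : ℤ) (a b : Fin n) (s : ℝ) :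
    cycleChar n j ⬝ᵥ pairState a b (s : ℂ)
      = (((Real.sqrt (1 + ‖(s : ℂ)‖ ^ 2))⁻¹ : ℝ) : ℂ) *
        (cycleChar n j a + s * cycleChar n j b) := by
  rw [pairState, dotProduct_smul, dotProduct_add, dotProduct_smul, dotProduct_single_one,
    dotProduct_single_one, smul_eq_mul, smul_eq_mul]

lemma eq_of_forall_cycleChar_dotProduct (v w : Fin n → ℂ)
    (h : ∀ j : Fin n, cycleChar n (j : ℕ) ⬝ᵥ v = cycleChar n (j : ℕ) ⬝ᵥ w) : v = w := by
  rw [← sub_eq_zero]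
  refine eq_zero_of_forall_sum_cycleChar _ fun j => ?_
  have := sub_eq_zero.mpr (h j)
  rwa [← dotProduct_sub] at this

/-- The common normalizing factor cancels, and `n` characters suffice to separate vectors. Letting
`j` range over all integers makes `-j` and `2j` available without reduction modulo `n`. -/
lemma stateTransferAt_iff (hn : 3 ≤ n) (x y t s : ℝ) (a b α β : Fin n) :
    StateTransferAt
      (x • (1 : Matrix (Fin n) (Fin n) ℝ) + y • (SimpleGraph.cycleGraph n).adjMatrix ℝ)
      (pairState a b (s : ℂ)) (pairState α β (s : ℂ)) t ↔
    ∃ η : ℂ, ‖η‖ = 1 ∧ ∀ j : ℤ,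
      Complex.exp (-(Complex.I * t) * (x + y * cycleEig n j)) *
        (cycleChar n j a + s * cycleChar n j b)
      = η * (cycleChar n j α + s * cycleChar n j β) := by
  unfold StateTransferAt
  refine exists_congr fun η => and_congr_right fun _ => ⟨fun h j => ?_, fun h => ?_⟩
  · have h2 := congrArg (fun v => cycleChar n j ⬝ᵥ v) h
    simp only [cycleChar_dotProduct_transitionMatrix hn, dotProduct_smul,
      cycleChar_dotProduct_pairState, smul_eq_mul] at h2
    refine mul_left_cancel₀ (pairState_factor_ne_zero s) ?_
    linear_combination h2
  · refine eq_of_forall_cycleChar_dotProduct _ _ fun j => ?_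
    rw [cycleChar_dotProduct_transitionMatrix hn, dotProduct_smul,
      cycleChar_dotProduct_pairState, cycleChar_dotProduct_pairState, smul_eq_mul]
    linear_combination (((Real.sqrt (1 + ‖(s : ℂ)‖ ^ 2))⁻¹ : ℝ) : ℂ) * h (j : ℕ)

/-- The scalar `x` multiplies everything by `exp(-itx)`, which is absorbed into `η`. -/
lemma stateTransferAt_add_adjMatrix_iff (hn : 3 ≤ n) (x t s : ℝ) (a b α β : Fin n) :
    StateTransferAt
      (x • (1 : Matrix (Fin n) (Fin n) ℝ) + (1 : ℝ) • (SimpleGraph.cycleGraph n).adjMatrix ℝ)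
      (pairState a b (s : ℂ)) (pairState α β (s : ℂ)) t ↔ CycleTransferAt n a b α β s t := by
  rw [stateTransferAt_iff hn]
  have key : ∀ j : ℤ, Complex.exp (-(Complex.I * t) * (x + (1 : ℝ) * cycleEig n j))
      = Complex.exp (-(Complex.I * t) * x) * Complex.exp (-(Complex.I * t) * cycleEig n j) := by
    intro j
    rw [← Complex.exp_add]
    congr 1
    push_cast
    ring
  constructor
  · rintro ⟨η, hη, h⟩
    refine ⟨Complex.exp (-(Complex.I * t) * (-x : ℝ)) * η, ?_, fun j => ?_⟩
    · rw [norm_mul, norm_exp_neg_I_mul, hη, one_mul]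
    · rw [mul_assoc, ← h j, key]
      have : Complex.exp (-(Complex.I * t) * (-x : ℝ)) * Complex.exp (-(Complex.I * t) * x) = 1 := by
        rw [← Complex.exp_add, ← Complex.exp_zero]
        congr 1
        push_cast
        ring
      linear_combination (- Complex.exp (-(Complex.I * t) * cycleEig n j) *
        (cycleChar n j a + s * cycleChar n j b)) * this
  · rintro ⟨η, hη, h⟩
    refine ⟨Complex.exp (-(Complex.I * t) * x) * η, ?_, fun j => ?_⟩
    · rw [norm_mul, norm_exp_neg_I_mul, hη, one_mul]
    · rw [key, mul_assoc, h j, mul_assoc]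

omit [NeZero n] in
/-- The conjugate of a transfer condition is the transfer condition at the opposite time. -/
lemma CycleTransferAt.neg {s t : ℝ} {a b α β : Fin n} (h : CycleTransferAt n a b α β s t) :
    CycleTransferAt n a b α β s (-t) := by
  obtain ⟨η, hη, h⟩ := h
  refine ⟨(starRingEnd ℂ) η, by rwa [RCLike.norm_conj], fun j => ?_⟩
  have h2 := congrArg (starRingEnd ℂ) (h (-j))
  simp only [map_mul, map_add, Complex.conj_ofReal, ← Complex.exp_conj, map_neg, Complex.conj_I,
    cycleChar_neg_index, Complex.conj_conj, cycleEig_neg] at h2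
  rw [← h2]
  congr 2
  push_cast
  ring

/-- Evolving under `-A` for time `t` is evolving under `A` for time `-t`, and the transfer condition
is symmetric under time reversal. -/
lemma stateTransferAt_sub_adjMatrix_iff (hn : 3 ≤ n) (x t s : ℝ) (a b α β : Fin n) :
    StateTransferAt
      (x • (1 : Matrix (Fin n) (Fin n) ℝ) + (-1 : ℝ) • (SimpleGraph.cycleGraph n).adjMatrix ℝ)
      (pairState a b (s : ℂ)) (pairState α β (s : ℂ)) t ↔ CycleTransferAt n a b α β s t := by
  have h1 : StateTransferAt
      (x • (1 : Matrix (Fin n) (Fin n) ℝ) + (-1 : ℝ) • (SimpleGraph.cycleGraph n).adjMatrix ℝ)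
      (pairState a b (s : ℂ)) (pairState α β (s : ℂ)) t ↔ CycleTransferAt n a b α β s (-t) := by
    rw [← stateTransferAt_add_adjMatrix_iff hn (-x), stateTransferAt_iff hn, stateTransferAt_iff hn]
    refine exists_congr fun η => and_congr_right fun _ => forall_congr' fun j => ?_
    rw [show -(Complex.I * t) * (x + (-1 : ℝ) * cycleEig n j)
      = -(Complex.I * (-t : ℝ)) * ((-x : ℝ) + (1 : ℝ) * cycleEig n j) by push_cast; ring]
  rw [h1]
  exact ⟨fun h => by simpa using h.neg, fun h => h.neg⟩

lemma stateTransferAt_cycle_iff (hn : 3 ≤ n) {M : Matrix (Fin n) (Fin n) ℝ}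
    (hM : M = (SimpleGraph.cycleGraph n).adjMatrix ℝ ∨
      M = (SimpleGraph.cycleGraph n).lapMatrix ℝ ∨
      M = signlessLapMatrix (SimpleGraph.cycleGraph n)) (a b α β : Fin n) (s t : ℝ) :
    StateTransferAt M (pairState a b (s : ℂ)) (pairState α β (s : ℂ)) t ↔
      CycleTransferAt n a b α β s t := by
  rcases hM with rfl | rfl | rfl
  · rw [← stateTransferAt_add_adjMatrix_iff hn 0]; simp
  · rw [← stateTransferAt_sub_adjMatrix_iff hn 2, SimpleGraph.lapMatrix, degMatrix_cycleGraph hn,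
      neg_one_smul, sub_eq_add_neg]
  · rw [← stateTransferAt_add_adjMatrix_iff hn 2, signlessLapMatrix, degMatrix_cycleGraph hn,
      one_smul]

omit [NeZero n] in
lemma sameState_pairState_iff (a b α β : Fin n) (s : ℝ) :
    SameState (pairState a b (s : ℂ)) (pairState α β (s : ℂ)) ↔
      ∃ η : ℂ, ‖η‖ = 1 ∧ ∀ x : Fin n, (if x = a then 1 else 0) + (s : ℂ) * (if x = b then 1 else 0)
        = η * ((if x = α then 1 else 0) + (s : ℂ) * (if x = β then 1 else 0)) := by
  refine exists_congr fun η => and_congr_right fun _ => ?_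
  rw [funext_iff]
  refine forall_congr' fun x => ?_
  simp only [pairState, Pi.smul_apply, Pi.add_apply, Pi.single_apply, smul_eq_mul]
  constructor
  · intro h
    refine mul_left_cancel₀ (pairState_factor_ne_zero s) ?_
    linear_combination h
  · intro h
    linear_combination ((((Real.sqrt (1 + ‖(s : ℂ)‖ ^ 2))⁻¹ : ℝ)) : ℂ) * h

lemma SameState.symm {V : Type*} {u v : V → ℂ} (h : SameState u v) : SameState v u := by
  obtain ⟨η, hη, rfl⟩ := h
  have h0 : η ≠ 0 := norm_ne_zero_iff.mp (by rw [hη]; exact one_ne_zero)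
  exact ⟨η⁻¹, by rw [norm_inv, hη, inv_one], by rw [smul_smul, inv_mul_cancel₀ h0, one_smul]⟩

lemma SameState.trans {V : Type*} {u v w : V → ℂ} (h : SameState u v) (h' : SameState v w) :
    SameState u w := by
  obtain ⟨η, hη, rfl⟩ := h
  obtain ⟨ζ, hζ, rfl⟩ := h'
  exact ⟨η * ζ, by rw [norm_mul, hη, hζ, one_mul], by rw [smul_smul]⟩

lemma StateTransferAt.congr_right {V : Type*} [Fintype V] [DecidableEq V] {M : Matrix V V ℝ}
    {u v w : V → ℂ} {t : ℝ} (h : StateTransferAt M u v t) (h' : SameState v w) :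
    StateTransferAt M u w t := by
  obtain ⟨η, hη, h⟩ := h
  obtain ⟨ζ, hζ, rfl⟩ := h'
  exact ⟨η * ζ, by rw [norm_mul, hη, hζ, one_mul], by rw [h, smul_smul]⟩

lemma PerfectStateTransfer.congr_right {V : Type*} [Fintype V] [DecidableEq V] {M : Matrix V V ℝ}
    {u v w : V → ℂ} (h : PerfectStateTransfer M u v) (h' : SameState v w) :
    PerfectStateTransfer M u w :=
  ⟨fun h2 => h.1 (h2.trans h'.symm), h.2.imp fun _ ht => ht.congr_right h'⟩

end Transfer

/-! ### Time-free consequences in the group algebra -/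

section Combinatorics

variable {n : ℕ} [NeZero n]

omit [NeZero n] in
lemma cycleChar_dotProduct_single_smul (j : ℤ) (a : Fin n) (c : ℂ) :
    cycleChar n j ⬝ᵥ (c • (Pi.single a 1 : Fin n → ℂ)) = c * cycleChar n j a := by
  rw [dotProduct_smul, dotProduct_single_one, smul_eq_mul]

omit [NeZero n] in
-- Conjugating the equation at `-j` restores `f_j` and `g_j` but conjugates the phases, so in the
-- product of the two equations all phases become 1.
lemma CycleTransferAt.sq_eq {s t : ℝ} {a b α β : Fin n} (h : CycleTransferAt n a b α β s t)
    (j : ℤ) :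
    (cycleChar n j a + s * cycleChar n j b) ^ 2 = (cycleChar n j α + s * cycleChar n j β) ^ 2 := by
  obtain ⟨η, hη, h⟩ := h
  have h1 := h j
  have h2 := congrArg (starRingEnd ℂ) (h (-j))
  simp only [map_mul, map_add, Complex.conj_ofReal, cycleChar_neg_index, Complex.conj_conj,
    cycleEig_neg] at h2
  have h3 := Complex.mul_conj (Complex.exp (-(Complex.I * t) * cycleEig n j))
  have h4 := Complex.mul_conj η
  rw [Complex.normSq_eq_norm_sq, norm_exp_neg_I_mul] at h3
  rw [Complex.normSq_eq_norm_sq, hη] at h4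
  push_cast at h3 h4
  set φ := Complex.exp (-(Complex.I * t) * cycleEig n j)
  have h5 := congrArg₂ (· * ·) h1 h2
  set f := cycleChar n j a + s * cycleChar n j b
  set g := cycleChar n j α + s * cycleChar n j β
  linear_combination h5 - f ^ 2 * h3 + g ^ 2 * h4

omit [NeZero n] in
lemma CycleTransferAt.mul_conj_eq {s t : ℝ} {a b α β : Fin n} (h : CycleTransferAt n a b α β s t)
    (j : ℤ) :
    (cycleChar n j a + s * cycleChar n j b) *
        (starRingEnd ℂ) (cycleChar n j a + s * cycleChar n j b)
      = (cycleChar n j α + s * cycleChar n j β) *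
        (starRingEnd ℂ) (cycleChar n j α + s * cycleChar n j β) := by
  obtain ⟨η, hη, h⟩ := h
  have h1 := congrArg norm (h j)
  rw [norm_mul, norm_mul, norm_exp_neg_I_mul, hη, one_mul, one_mul] at h1
  rw [Complex.mul_conj, Complex.mul_conj, Complex.normSq_eq_norm_sq, Complex.normSq_eq_norm_sq, h1]

/-- Pointwise products of transforms are transforms of convolutions, so `sq_eq` is an identity
between squares in the group algebra, read off here at the point `x`. -/
lemma CycleTransferAt.sq_apply {s t : ℝ} {b α β : Fin n} (h : CycleTransferAt n 0 b α β s t)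
    (x : Fin n) :
    (if x = 0 then 1 else 0) + 2 * s * (if x = b then 1 else 0)
        + s ^ 2 * (if x = b + b then 1 else 0)
      = (if x = α + α then 1 else 0) + 2 * s * (if x = α + β then 1 else 0)
        + s ^ 2 * (if x = β + β then 1 else 0) := by
  have key := eq_of_forall_cycleChar_dotProduct
    ((1 : ℂ) • (Pi.single 0 1 : Fin n → ℂ) + (2 * s : ℂ) • (Pi.single b 1 : Fin n → ℂ)
      + (s ^ 2 : ℂ) • (Pi.single (b + b) 1 : Fin n → ℂ))
    ((1 : ℂ) • (Pi.single (α + α) 1 : Fin n → ℂ) + (2 * s : ℂ) • (Pi.single (α + β) 1 : Fin n → ℂ)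
      + (s ^ 2 : ℂ) • (Pi.single (β + β) 1 : Fin n → ℂ)) (fun j => by
      simp only [dotProduct_add, cycleChar_dotProduct_single_smul, cycleChar_add]
      have := h.sq_eq (j : ℕ)
      rw [cycleChar_zero] at this
      rw [cycleChar_zero]
      linear_combination this)
  have := congrFun key x
  simp only [Pi.smul_apply, Pi.add_apply, Pi.single_apply, smul_eq_mul] at this
  rw [← Complex.ofReal_inj]
  push_cast
  simp only [apply_ite Complex.ofReal, Complex.ofReal_one, Complex.ofReal_zero]
  linear_combination this

/-- In `|f_j|² = |g_j|²` the constant `1 + s²` cancels and a factor `s ≠ 0` divides out. What is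
left compares the difference sets of the two pairs. -/
lemma CycleTransferAt.mul_conj_apply {s t : ℝ} {b α β : Fin n} (hs : s ≠ 0)
    (h : CycleTransferAt n 0 b α β s t) (x : Fin n) :
    ((if x = b then 1 else 0) + (if x = -b then 1 else 0) : ℝ)
      = (if x = β + -α then 1 else 0) + (if x = α + -β then 1 else 0) := by
  have key := eq_of_forall_cycleChar_dotProduct
    ((1 : ℂ) • (Pi.single b 1 : Fin n → ℂ) + (1 : ℂ) • (Pi.single (-b) 1 : Fin n → ℂ))
    ((1 : ℂ) • (Pi.single (β + -α) 1 : Fin n → ℂ) + (1 : ℂ) • (Pi.single (α + -β) 1 : Fin n → ℂ))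
    (fun j => by
      simp only [dotProduct_add, cycleChar_dotProduct_single_smul, cycleChar_add, cycleChar_neg]
      have h1 := h.mul_conj_eq (j : ℕ)
      simp only [cycleChar_zero, map_add, map_mul, map_one, Complex.conj_ofReal] at h1
      have hc : ∀ a : Fin n, cycleChar n (j : ℕ) a * (starRingEnd ℂ) (cycleChar n (j : ℕ) a) = 1 := by
        intro a
        rw [Complex.mul_conj, Complex.normSq_eq_norm_sq, norm_cycleChar]; simp
      have hs' : (s : ℂ) ≠ 0 := by exact_mod_cast hs
      refine mul_left_cancel₀ hs' ?_
      linear_combination h1 - (s : ℂ) ^ 2 * hc b + (s : ℂ) ^ 2 * hc β + hc α)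
  have := congrFun key x
  simp only [Pi.smul_apply, Pi.add_apply, Pi.single_apply, smul_eq_mul, one_mul] at this
  rw [← Complex.ofReal_inj]
  push_cast
  simp only [apply_ite Complex.ofReal, Complex.ofReal_one, Complex.ofReal_zero]
  linear_combination this

end Combinatorics

/-! ### Pairs with equal squares in the group algebra of an abelian group -/

section AddCommGroup

variable {G : Type*} [AddCommGroup G] [DecidableEq G]

lemma eq_add_or_eq_add_of_indicator {b α β : G}
    (h : ∀ x : G, ((if x = b then 1 else 0) + (if x = -b then 1 else 0) : ℝ)
      = (if x = β + -α then 1 else 0) + (if x = α + -β then 1 else 0)) :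
    β = α + b ∨ α = β + b := by
  by_contra! hne
  have h1 : b ≠ β + -α := fun h => hne.1 (by rw [h]; abel)
  have h2 : b ≠ α + -β := fun h => hne.2 (by rw [h]; abel)
  have h0 := h b
  rw [if_pos rfl, if_neg h1, if_neg h2] at h0
  split_ifs at h0 <;> norm_num at h0

/-- If a translate of `e_0 + 2 s e_b + s² e_{2b}` is the same element of the group algebra, the
translation is trivial up to the one exception listed. -/
lemma translate_square_pair {b c : G} {s : ℝ} (hb : b ≠ 0) (hs : s ≠ 0)
    (h : ∀ x : G, (if x = 0 then 1 else 0) + 2 * s * (if x = b then 1 else 0)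
        + s ^ 2 * (if x = b + b then 1 else 0)
      = (if x = c then 1 else 0) + 2 * s * (if x = c + b then 1 else 0)
        + s ^ 2 * (if x = c + (b + b) then 1 else 0)) :
    c = 0 ∨ (b + b = 0 ∧ c = b ∧ s = 1) := by
  by_cases hc : c = 0
  · exact Or.inl hc
  right
  have h0 := h 0
  have h1 := h b
  have hbb : b ≠ b + b := by simpa using hb
  have hbcb : b ≠ c + b := by simpa using hc
  rw [if_pos rfl, if_neg (Ne.symm hb), if_neg (Ne.symm hc)] at h0
  rw [if_pos rfl, if_neg hb, if_neg hbb, if_neg hbcb] at h1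
  by_cases h2 : b + b = 0
  · refine ⟨h2, ?_⟩
    -- The coefficient at 0 is `1 + s²` on the left and `2s` or 0 on the right, so it must be `2s`
    -- and `(s - 1)² = 0`.
    rw [h2, add_zero, if_pos rfl, if_neg (Ne.symm hc)] at h0
    by_cases h3 : 0 = c + b
    · rw [if_pos h3] at h0
      refine ⟨add_right_cancel (h3.symm.trans h2.symm), by nlinarith⟩
    · rw [if_neg h3] at h0
      nlinarith
  · exfalso
    rw [if_neg (Ne.symm h2)] at h0
    -- If `c = -b`, the coefficients at 0 and `b` give `2s = 1` and `2s = s²`. Otherwise `c = -2b`,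
    -- and they give `s² = 1` and `2s = 0` or `2s = 1`.
    by_cases h3 : 0 = c + b
    · have h4 : (0 : G) ≠ c + (b + b) := by
        rw [← add_assoc, ← h3, zero_add]; exact hb.symm
      have h5 : b ≠ c := by
        rintro rfl; exact h2 h3.symm
      have h6 : b = c + (b + b) := by rw [← add_assoc, ← h3, zero_add]
      rw [if_pos h3, if_neg h4] at h0
      rw [if_neg h5, if_pos h6] at h1
      nlinarith
    · rw [if_neg h3] at h0
      have h4 : (0 : G) = c + (b + b) := by
        by_contra h4
        rw [if_neg h4] at h0
        norm_num at h0
      have h5 : b ≠ c + (b + b) := by rw [← h4]; exact hb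
      rw [if_pos h4] at h0
      rw [if_neg h5] at h1
      split_ifs at h1
      · nlinarith
      · apply hs; nlinarith

/-- The reflection of `e_0 + 2 s e_b + s² e_{2b}`, translated by `d`, against the element
itself. -/
lemma reflect_square_pair {b d : G} {s : ℝ} (hb : b ≠ 0) (h2 : b + b ≠ 0) (hs : s ≠ 0)
    (h : ∀ x : G, (if x = 0 then 1 else 0) + 2 * s * (if x = b then 1 else 0)
        + s ^ 2 * (if x = b + b then 1 else 0)
      = (if x = d + (b + b) then 1 else 0) + 2 * s * (if x = d + b then 1 else 0)
        + s ^ 2 * (if x = d then 1 else 0)) :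
    (s ^ 2 = 1 ∧ d = 0) ∨ (s = 2 ∧ b + b + b = 0 ∧ d + (b + b) = 0) ∨
      (s = 1 / 2 ∧ b + b + b = 0 ∧ d + b = 0) := by
  have hbb : b ≠ b + b := by simpa using hb
  have h0 := h 0
  rw [if_pos rfl, if_neg (Ne.symm hb), if_neg (Ne.symm h2)] at h0
  by_cases hd : d = 0
  · subst hd
    left
    simp only [zero_add, if_neg (Ne.symm hb), if_neg (Ne.symm h2), if_true] at h0
    exact ⟨by linarith, rfl⟩
  right
  rw [if_neg (Ne.symm hd)] at h0
  by_cases h3 : d + b = 0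
  · right
    have h4 : d = -b := eq_neg_of_add_eq_zero_left h3
    have h5 : (0 : G) ≠ d + (b + b) := by rw [h4, neg_add_cancel_left]; exact hb.symm
    rw [if_neg h5, if_pos h3.symm] at h0
    refine ⟨by linarith, ?_, h3⟩
    -- The right side has coefficient `s²` at `d`; the left side can match it only if `d = 2b`,
    -- which with `d = -b` is `3b = 0`.
    have h6 := h d
    rw [if_neg hd, if_pos rfl] at h6
    have h7 : d ≠ d + b := by simpa using hb
    have h8 : d ≠ d + (b + b) := by simpa using h2
    have h9 : d ≠ b := by rintro rfl; exact h2 h3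
    rw [if_neg h7, if_neg h8, if_neg h9] at h6
    by_contra h10
    have h11 : d ≠ b + b := by
      intro h; apply h10; rw [← h, h3]
    rw [if_neg h11] at h6
    have : s ^ 2 ≠ 0 := pow_ne_zero 2 hs
    apply this; linarith
  · left
    rw [if_neg (Ne.symm h3)] at h0
    have h4 : d + (b + b) = 0 := by
      by_contra h4
      rw [if_neg (Ne.symm h4)] at h0
      norm_num at h0
    have h5 : d + b = -b := by
      rw [eq_neg_iff_add_eq_zero, add_assoc, h4]
    -- The right side has coefficient `2s` at `d + b = -b`; matching it needs `-b = 2b` and `s² =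
    -- 2s`.
    have h6 := h (d + b)
    have h7 : d + b ≠ d := by simpa using hb
    have h8 : d + b ≠ d + (b + b) := by simpa using hbb
    have h9 : d + b ≠ b := by simpa using hd
    rw [if_neg h3, if_neg h9, if_neg h7, if_neg h8, if_pos rfl] at h6
    by_cases h10 : d + b = b + b
    · rw [if_pos h10] at h6
      have h11 : s * (s - 2) = 0 := by linarith
      refine ⟨?_, by rw [← h10, add_assoc, h4], h4⟩
      have := (mul_eq_zero.mp h11).resolve_left hs
      linarith
    · rw [if_neg h10] at h6
      exact absurd (by linarith) hs

end AddCommGroup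

/-- The combinatorial part of the classification: the possible final states. -/
lemma CycleTransferAt.final_state {n : ℕ} [NeZero n] {s t : ℝ} {b α β : Fin n} (hb : b ≠ 0)
    (hs : s ≠ 0) (h : CycleTransferAt n 0 b α β s t) :
    (β = α + b ∧ (α + α = 0 ∨ (b + b = 0 ∧ α + α = b ∧ s = 1))) ∨
    (α = β + b ∧ s ^ 2 = 1 ∧ β + β = 0) ∨
    (α = β + b ∧ s = 2 ∧ b + b + b = 0 ∧ α + α = 0) ∨
    (α = β + b ∧ s = 1 / 2 ∧ b + b + b = 0 ∧ α + α = b) := by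
  by_cases h2 : β = α + b
  · left
    refine ⟨h2, translate_square_pair hb hs fun x => ?_⟩
    -- The target is the source translated by `α`, so its square is translated by `2α`.
    rw [h.sq_apply x, h2, add_assoc α α b, show α + b + (α + b) = α + α + (b + b) by abel]
  · right
    have h3 : α = β + b :=
      (eq_add_or_eq_add_of_indicator (h.mul_conj_apply hs)).resolve_left h2
    have h4 : b + b ≠ 0 := by
      intro h5; apply h2; rw [h3, add_assoc, h5, add_zero]
    -- The target carries the weights in the opposite order, so its square is the reflected one,
    -- based at `2β`.
    have := reflect_square_pair (d := β + β) hb h4 hs fun x => by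
      rw [h.sq_apply x, h3, show β + b + (β + b) = β + β + (b + b) by abel,
        show β + b + β = β + β + b by abel]
    have h6 : α + α = β + β + (b + b) := by rw [h3]; abel
    rcases this with ⟨h7, h8⟩ | ⟨h7, h8, h9⟩ | ⟨h7, h8, h9⟩
    · exact Or.inl ⟨h3, h7, h8⟩
    · exact Or.inr (Or.inl ⟨h3, h7, h8, h6.trans h9⟩)
    · refine Or.inr (Or.inr ⟨h3, h7, h8, ?_⟩)
      rw [h6, ← add_assoc, h9, zero_add]

/-! ### Characters in the support of the initial state -/

section Support

variable {n : ℕ} [NeZero n] {s : ℝ} {b : Fin n} {j : ℤ}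

/-- Vanishing would require `|s| = 1`, since characters have modulus 1. -/
lemma one_add_cycleChar_ne_zero_of_sq_ne_one (hs : s ^ 2 ≠ 1) :
    cycleChar n j 0 + s * cycleChar n j b ≠ 0 := by
  intro h
  apply hs
  rw [cycleChar_zero] at h
  have h1 := congrArg norm (eq_neg_of_add_eq_zero_left h)
  rw [norm_one, norm_neg, norm_mul, norm_cycleChar, mul_one, Complex.norm_real, Real.norm_eq_abs]
    at h1
  rw [← sq_abs, ← h1, one_pow]

lemma one_add_cycleChar_ne_zero_of_one (h : ∀ k : ℤ, 2 * (j * (b : ℕ)) ≠ (2 * k + 1) * n) :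
    cycleChar n j 0 + ((1 : ℝ) : ℂ) * cycleChar n j b ≠ 0 := by
  intro h0
  have h1 := congrArg Complex.re h0
  rw [cycleChar_zero, Complex.add_re, Complex.re_ofReal_mul, cycleChar_re] at h1
  simp only [Complex.one_re, one_mul, Complex.zero_re] at h1
  obtain ⟨k, hk⟩ := Real.cos_eq_neg_one_iff.mp (eq_neg_of_add_eq_zero_right h1)
  apply h k
  have hn : (n : ℝ) ≠ 0 := by exact_mod_cast NeZero.ne n
  field_simp at hk
  have : ((2 * (j * (b : ℕ)) : ℤ) : ℝ) = (((2 * k + 1) * n : ℤ) : ℝ) := by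
    push_cast
    linarith
  exact_mod_cast this

lemma one_add_cycleChar_ne_zero_of_neg_one (h : ¬ (n : ℤ) ∣ j * (b : ℕ)) :
    cycleChar n j 0 + ((-1 : ℝ) : ℂ) * cycleChar n j b ≠ 0 := by
  intro h0
  have h1 := congrArg Complex.re h0
  rw [cycleChar_zero, Complex.add_re, Complex.re_ofReal_mul, cycleChar_re] at h1
  simp only [Complex.one_re, Complex.zero_re] at h1
  obtain ⟨k, hk⟩ := (Real.cos_eq_one_iff _).mp
    (show Real.cos (2 * Real.pi * j * (b : ℕ) / n) = 1 by linarith)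
  apply h
  refine ⟨k, ?_⟩
  have hn : (n : ℝ) ≠ 0 := by exact_mod_cast NeZero.ne n
  field_simp at hk
  have : ((j * (b : ℕ) : ℤ) : ℝ) = ((n * k : ℤ) : ℝ) := by
    push_cast
    linarith
  exact_mod_cast this

end Support

/-! ### Rational eigenvalue ratios and Niven's theorem -/

section Rationality

lemma exists_rat_mul_of_mul_eq_rat_mul_pi {t x y : ℝ} (ht : t ≠ 0) (hy : y ≠ 0)
    (hx' : ∃ q : ℚ, t * x = q * Real.pi) (hy' : ∃ q : ℚ, t * y = q * Real.pi) :
    ∃ q : ℚ, x = q * y := by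
  obtain ⟨p, hp⟩ := hx'
  obtain ⟨q, hq⟩ := hy'
  have hq0 : (q : ℝ) ≠ 0 := by
    intro h
    rw [h, zero_mul] at hq
    exact mul_ne_zero ht hy hq
  refine ⟨p / q, ?_⟩
  push_cast
  rw [div_mul_eq_mul_div, eq_div_iff hq0]
  refine mul_left_cancel₀ ht ?_
  linear_combination q * hp - p * hq

/-- The indices `j` in the support of `u` have `t θ_j` congruent modulo `π`. -/
lemma CycleTransferAt.exists_rat {n : ℕ} {s t : ℝ} {a b α β : Fin n}
    (h : CycleTransferAt n a b α β s t) {j k : ℤ}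
    (hj : cycleChar n j a + s * cycleChar n j b ≠ 0)
    (hk : cycleChar n k a + s * cycleChar n k b ≠ 0) :
    ∃ q : ℚ, t * (cycleEig n j - cycleEig n k) = q * Real.pi := by
  have hsq := h.sq_eq
  obtain ⟨η, hη, h⟩ := h
  have key : ∀ i : ℤ, cycleChar n i a + s * cycleChar n i b ≠ 0 →
      Complex.exp (2 * (-(Complex.I * t) * cycleEig n i)) = η ^ 2 := by
    intro i hi
    -- On the support `g_i = ±f_i` with unknown sign; squaring removes it.
    have h1 := congrArg (· ^ 2) (h i)
    simp only [mul_pow] at h1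
    rw [← hsq i] at h1
    rw [← mul_right_cancel₀ (pow_ne_zero 2 hi) h1, ← Complex.exp_nat_mul]
    norm_cast
  obtain ⟨z, hz⟩ := Complex.exp_eq_exp_iff_exists_int.mp ((key j hj).trans (key k hk).symm)
  refine ⟨-z, ?_⟩
  have hI := Complex.I_ne_zero
  have : ((t * (cycleEig n j - cycleEig n k) : ℝ) : ℂ) = (((-z : ℚ) * Real.pi : ℝ) : ℂ) := by
    refine mul_left_cancel₀ hI (mul_left_cancel₀ (two_ne_zero (α := ℂ)) ?_)
    push_cast
    linear_combination -hz
  exact_mod_cast this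

/-- By Niven's theorem an angle in `[0, π]` that is a rational multiple of `π` with rational cosine
is 0, `π/3`, `π/2`, `2π/3` or `π`; here 0 is excluded by `0 < k`. -/
lemma cos_two_pi_mul_div_rat {n k : ℕ} (hn : 0 < n) (hk : 0 < k) (hkn : 2 * k ≤ n)
    (h : ∃ q : ℚ, Real.cos (2 * Real.pi * k / n) = q) :
    n = 6 * k ∨ n = 4 * k ∨ n = 3 * k ∨ n = 2 * k := by
  have hn' : (0 : ℝ) < n := by exact_mod_cast hn
  have hk' : (0 : ℝ) < k := by exact_mod_cast hk
  have hπ := Real.pi_pos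
  have hkn' : (2 : ℝ) * k ≤ n := by exact_mod_cast hkn
  have h1 := niven_angle_eq ⟨2 * k / n, by push_cast; ring⟩ h
    ⟨by positivity, by rw [div_le_iff₀ hn']; nlinarith⟩
  simp only [Set.mem_insert_iff, Set.mem_singleton_iff] at h1
  have hπ0 := hπ.ne'
  rcases h1 with h1 | h1 | h1 | h1 | h1
  · exfalso
    have : 0 < 2 * Real.pi * k / n := by positivity
    linarith
  · left
    field_simp at h1
    have : (n : ℝ) = 6 * k := by linarith
    exact_mod_cast this
  · right; left
    field_simp at h1
    have : (n : ℝ) = 4 * k := by linarith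
    exact_mod_cast this
  · right; right; left
    field_simp at h1
    have : (n : ℝ) = 3 * k := by linarith
    exact_mod_cast this
  · right; right; right
    field_simp at h1
    have : (n : ℝ) = 2 * k := by linarith
    exact_mod_cast this

lemma eq_four_or_six_of_cos_rat {n : ℕ} (hn : 4 ≤ n)
    (h : ∃ q : ℚ, Real.cos (2 * Real.pi / n) = q) : n = 4 ∨ n = 6 := by
  have := cos_two_pi_mul_div_rat (n := n) (k := 1) (by omega) (by omega) (by omega) (by simpa using h)
  omega

variable {n : ℕ}

lemma cycleEig_zero : cycleEig n 0 = 2 := by simp [cycleEig]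

lemma cycleEig_one : cycleEig n 1 = 2 * Real.cos (2 * Real.pi / n) := by simp [cycleEig]

lemma cycleEig_two_mul (j : ℤ) : cycleEig n (2 * j) = cycleEig n j ^ 2 - 2 := by
  unfold cycleEig
  rw [show 2 * Real.pi * ((2 * j : ℤ) : ℝ) / n = 2 * (2 * Real.pi * j / n) by push_cast; ring,
    Real.cos_two_mul]
  ring

lemma cycleEig_three_mul (j : ℤ) :
    cycleEig n (3 * j) = cycleEig n j ^ 3 - 3 * cycleEig n j := by
  unfold cycleEig
  rw [show 2 * Real.pi * ((3 * j : ℤ) : ℝ) / n = 3 * (2 * Real.pi * j / n) by push_cast; ring,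
    Real.cos_three_mul]
  ring

lemma cycleEig_two : cycleEig n 2 = cycleEig n 1 ^ 2 - 2 := by
  simpa using cycleEig_two_mul (n := n) 1

lemma cycleEig_three : cycleEig n 3 = cycleEig n 1 ^ 3 - 3 * cycleEig n 1 := by
  simpa using cycleEig_three_mul (n := n) 1

lemma cycleEig_four : cycleEig n 4 = (cycleEig n 1 ^ 2 - 2) ^ 2 - 2 := by
  rw [← cycleEig_two, ← cycleEig_two_mul]; norm_num

/-- The bipartite symmetry of an even cycle. It supplies opposite eigenvalues when the character 0
is missing from the support. -/
lemma cycleEig_half_sub {m : ℕ} (hm : 0 < m) (hn : n = 2 * m) (j : ℤ) :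
    cycleEig n (m - j) = -cycleEig n j := by
  subst hn
  have : (m : ℝ) ≠ 0 := by exact_mod_cast hm.ne'
  unfold cycleEig
  rw [show 2 * Real.pi * ((m - j : ℤ) : ℝ) / (2 * m : ℕ)
    = Real.pi - 2 * Real.pi * j / (2 * m : ℕ) by push_cast; field_simp, Real.cos_pi_sub]
  ring

lemma eq_four_or_six_of_cycleEig_one_rat (hn : 4 ≤ n) (h : ∃ q : ℚ, cycleEig n 1 = q) :
    n = 4 ∨ n = 6 := by
  obtain ⟨q, hq⟩ := h
  refine eq_four_or_six_of_cos_rat hn ⟨q / 2, ?_⟩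
  rw [cycleEig_one] at hq
  push_cast
  linarith

lemma cycleEig_lt_two {j : ℕ} (hj : 0 < j) (hjn : j < n) : cycleEig n j < 2 := by
  have h1 := Real.cos_le_one (2 * Real.pi * (j : ℤ) / n)
  have h2 : Real.cos (2 * Real.pi * (j : ℤ) / n) ≠ 1 := by
    intro h
    obtain ⟨k, hk⟩ := (Real.cos_eq_one_iff _).mp h
    have hn : (n : ℝ) ≠ 0 := by exact_mod_cast (by omega : n ≠ 0)
    have hπ := Real.pi_pos.ne'
    field_simp at hk
    have h3 : ((n * k : ℤ) : ℝ) = ((j : ℤ) : ℝ) := by push_cast at hk ⊢; linarith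
    have h4 : (n : ℤ) * k = j := by exact_mod_cast h3
    have h5 : (n : ℤ) ∣ j := ⟨k, h4.symm⟩
    have := Int.le_of_dvd (by omega) h5
    omega
  unfold cycleEig
  have := lt_of_le_of_ne h1 h2
  linarith

end Rationality

/-! ### Bounding the length of the cycle -/

section Size

variable {n : ℕ} [NeZero n] {s t : ℝ} {b α β : Fin n}

omit [NeZero n] in
/-- If the support of `u` contains `0, j, 2j`, then `cos (2π j / n)` is rational. -/
lemma CycleTransferAt.cycleEig_rat {a : Fin n} (h : CycleTransferAt n a b α β s t) (ht : t ≠ 0)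
    {j : ℤ} (hj : cycleEig n j < 2)
    (h0 : cycleChar n 0 a + s * cycleChar n 0 b ≠ 0)
    (h1 : cycleChar n j a + s * cycleChar n j b ≠ 0)
    (h2 : cycleChar n (2 * j) a + s * cycleChar n (2 * j) b ≠ 0) :
    ∃ q : ℚ, cycleEig n j = q := by
  obtain ⟨q, hq⟩ := exists_rat_mul_of_mul_eq_rat_mul_pi ht
    (y := cycleEig n 0 - cycleEig n j) (by rw [cycleEig_zero]; linarith)
    (h.exists_rat h0 h2) (h.exists_rat h0 h1)
  -- With `x = θ_j` the ratio is `(4 - x²)/(2 - x) = 2 + x`.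
  rw [cycleEig_zero, cycleEig_two_mul] at hq
  refine ⟨q - 2, ?_⟩
  push_cast
  have h3 : 2 - cycleEig n j ≠ 0 := by linarith
  refine mul_left_cancel₀ h3 ?_
  linear_combination hq

lemma CycleTransferAt.size_of_sq_ne_one (h : CycleTransferAt n 0 b α β s t) (ht : t ≠ 0)
    (hn : 4 ≤ n) (hs : s ^ 2 ≠ 1) : n = 4 ∨ n = 6 :=
  eq_four_or_six_of_cycleEig_one_rat hn (h.cycleEig_rat ht
    (by exact_mod_cast cycleEig_lt_two (j := 1) (by omega) (by omega))
    (one_add_cycleChar_ne_zero_of_sq_ne_one hs) (one_add_cycleChar_ne_zero_of_sq_ne_one hs)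
    (one_add_cycleChar_ne_zero_of_sq_ne_one hs))

lemma CycleTransferAt.size_of_one (h : CycleTransferAt n 0 b α β 1 t) (ht : t ≠ 0)
    (hn : 4 ≤ n) (hb : 1 ≤ (b : ℕ)) (hbn : 2 * (b : ℕ) < n) : n = 4 ∨ n = 6 := by
  have hn0 : (4 : ℤ) ≤ n := by exact_mod_cast hn
  have hb0 : (1 : ℤ) ≤ (b : ℕ) := by exact_mod_cast hb
  have hbn0 : 2 * ((b : ℕ) : ℤ) < n := by exact_mod_cast hbn
  have h0 : cycleChar n 0 0 + ((1 : ℝ) : ℂ) * cycleChar n 0 b ≠ 0 :=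
    one_add_cycleChar_ne_zero_of_one fun k hk => by
      have : (2 * k + 1) * (n : ℤ) = 0 := by linarith
      rcases mul_eq_zero.mp this with h | h <;> omega
  have h1 : cycleChar n 1 0 + ((1 : ℝ) : ℂ) * cycleChar n 1 b ≠ 0 :=
    one_add_cycleChar_ne_zero_of_one fun k hk => by
      have h2 : k < 0 := by nlinarith
      have h3 : 0 ≤ k := by nlinarith
      omega
  have hlt : cycleEig n 1 < 2 := by
    exact_mod_cast cycleEig_lt_two (j := 1) (by omega) (by omega)
  by_cases hb4 : 4 * (b : ℕ) = n
  -- Now `χ_j(b) = i^j`, so `j = 2` is lost; the indices 0, 1, 3, 4 are used instead.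
  · have hb4' : 4 * ((b : ℕ) : ℤ) = n := by exact_mod_cast hb4
    have h3 : cycleChar n 3 0 + ((1 : ℝ) : ℂ) * cycleChar n 3 b ≠ 0 :=
      one_add_cycleChar_ne_zero_of_one fun k hk => by
        have h2 : k < 1 := by nlinarith
        have h3 : 0 < k := by nlinarith
        omega
    have h4 : cycleChar n 4 0 + ((1 : ℝ) : ℂ) * cycleChar n 4 b ≠ 0 :=
      one_add_cycleChar_ne_zero_of_one fun k hk => by
        have h2 : k < 1 := by nlinarith
        have h3 : 0 < k := by nlinarith
        omega
    have hd : cycleEig n 0 - cycleEig n 1 ≠ 0 := by rw [cycleEig_zero]; linarith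
    obtain ⟨p, hp⟩ := exists_rat_mul_of_mul_eq_rat_mul_pi ht hd
      (h.exists_rat h0 h3) (h.exists_rat h0 h1)
    obtain ⟨q, hq⟩ := exists_rat_mul_of_mul_eq_rat_mul_pi ht hd
      (h.exists_rat h0 h4) (h.exists_rat h0 h1)
    rw [cycleEig_zero, cycleEig_three] at hp
    rw [cycleEig_zero, cycleEig_four] at hq
    apply eq_four_or_six_of_cycleEig_one_rat hn
    set x := cycleEig n 1
    have hd' : 2 - x ≠ 0 := by linarith
    -- From `2 - θ_3 = (2 - x)(x + 1)²` and `2 - θ_4 = (2 - x)(x + 2)x²`. Since `p - 1 = x² + 2x`,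
    -- the second ratio is `x(p - 1)`, which recovers `x` unless `p = 1`.
    have hp' : (x + 1) ^ 2 = p := mul_left_cancel₀ hd' (by linear_combination hp)
    have hq' : (x + 2) * x ^ 2 = q := mul_left_cancel₀ hd' (by linear_combination hq)
    have hq2 : x * (p - 1) = q := by rw [← hq', ← hp']; ring
    by_cases hp1 : (p : ℝ) = 1
    · have : x * (x + 2) = 0 := by linear_combination hp' + hp1
      rcases mul_eq_zero.mp this with h | h
      · exact ⟨0, by simpa using h⟩
      · exact ⟨-2, by push_cast; linarith⟩
    · refine ⟨q / (p - 1), ?_⟩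
      push_cast
      rw [eq_div_iff (sub_ne_zero.mpr hp1), hq2]
  · have hb4' : 4 * ((b : ℕ) : ℤ) ≠ n := by exact_mod_cast hb4
    exact eq_four_or_six_of_cycleEig_one_rat hn (h.cycleEig_rat ht hlt h0 h1
      (one_add_cycleChar_ne_zero_of_one fun k hk => by
        have h2 : k < 1 := by nlinarith
        have h3 : 0 ≤ k := by nlinarith
        obtain rfl : k = 0 := by omega
        omega))

/-- Exactly the odd characters are lost, so the argument runs on 0, 2, 4 and makes `cos (4π/n)`
rational. -/
lemma CycleTransferAt.size_of_one_of_antipodal (h : CycleTransferAt n 0 b α β 1 t) (ht : t ≠ 0)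
    (hn : 4 ≤ n) (hbn : 2 * (b : ℕ) = n) : n = 4 ∨ n = 6 ∨ n = 8 ∨ n = 12 := by
  have hn0 : (4 : ℤ) ≤ n := by exact_mod_cast hn
  have hbn0 : 2 * ((b : ℕ) : ℤ) = n := by exact_mod_cast hbn
  have hsupp : ∀ j : ℤ, cycleChar n (2 * j) 0 + ((1 : ℝ) : ℂ) * cycleChar n (2 * j) b ≠ 0 :=
    fun j => one_add_cycleChar_ne_zero_of_one fun k hk => by
      have h1 : (n : ℤ) * (2 * j - (2 * k + 1)) = 0 := by rw [← hbn0] at hk ⊢; linarith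
      rcases mul_eq_zero.mp h1 with h | h <;> omega
  obtain ⟨q, hq⟩ := h.cycleEig_rat ht (j := 2)
    (by exact_mod_cast cycleEig_lt_two (j := 2) (by omega) (by omega))
    (by simpa using hsupp 0) (by simpa using hsupp 1) (hsupp 2)
  have := cos_two_pi_mul_div_rat (n := n) (k := 2) (by omega) (by omega) (by omega)
    ⟨q / 2, by
      unfold cycleEig at hq
      push_cast at hq ⊢
      linarith⟩
  omega

/-- The character 0 is lost, so differences from `θ_0` are unavailable. For `n = 2m` the indices 1
and `m - 1` have opposite eigenvalues, which makes `t θ_1`, and then each `t θ_j` on the support, a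
rational multiple of `π`; eigenvalues themselves can then be compared. -/
lemma CycleTransferAt.size_of_neg_one (h : CycleTransferAt n 0 b α β (-1) t) (ht : t ≠ 0)
    (hn : 4 ≤ n) (heven : Even n) (hb : 1 ≤ (b : ℕ)) (hbn : 2 * (b : ℕ) < n) :
    n = 4 ∨ n = 6 ∨ (n = 8 ∧ (b : ℕ) = 2) := by
  obtain ⟨m, hm⟩ := heven
  have hm : n = 2 * m := by omega
  have hnm : (n : ℤ) = 2 * m := by exact_mod_cast hm
  have hrat : ∀ j k : ℤ, ¬ (n : ℤ) ∣ j * (b : ℕ) → ¬ (n : ℤ) ∣ k * (b : ℕ) →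
      ∃ q : ℚ, t * (cycleEig n j - cycleEig n k) = q * Real.pi := fun j k hj hk =>
    h.exists_rat (one_add_cycleChar_ne_zero_of_neg_one hj)
      (one_add_cycleChar_ne_zero_of_neg_one hk)
  have hb0 : (1 : ℤ) ≤ (b : ℕ) := by exact_mod_cast hb
  have hbn0 : ((b : ℕ) : ℤ) < m := by omega
  have h1 : ¬ (n : ℤ) ∣ 1 * (b : ℕ) := fun hd => by
    have := Int.le_of_dvd (by omega) hd
    omega
  have h2 : ¬ (n : ℤ) ∣ 2 * (b : ℕ) := fun hd => by
    have := Int.le_of_dvd (by omega) hd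
    omega
  have hm1 : ¬ (n : ℤ) ∣ (m - 1) * (b : ℕ) := fun hd => by
    have h3 : (n : ℤ) ∣ 2 * (b : ℕ) := by
      have : (2 * (b : ℕ) : ℤ) = n * (b : ℕ) - 2 * ((m - 1) * (b : ℕ)) := by rw [hnm]; ring
      rw [this]
      exact dvd_sub (Dvd.intro _ rfl) (hd.mul_left 2)
    exact h2 h3
  have hx : ∃ q : ℚ, t * cycleEig n 1 = q * Real.pi := by
    obtain ⟨q, hq⟩ := hrat 1 (m - 1) h1 hm1
    rw [cycleEig_half_sub (by omega) hm] at hq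
    exact ⟨q / 2, by push_cast; linarith⟩
  have hj : ∀ j : ℤ, ¬ (n : ℤ) ∣ j * (b : ℕ) → ∃ q : ℚ, t * cycleEig n j = q * Real.pi := by
    intro j hj
    obtain ⟨p, hp⟩ := hx
    obtain ⟨q, hq⟩ := hrat j 1 hj h1
    exact ⟨p + q, by push_cast; linarith⟩
  suffices hs : (∃ q : ℚ, cycleEig n 1 = q) ∨ (n = 8 ∧ (b : ℕ) = 2) by
    rcases hs with hs | hs
    · have := eq_four_or_six_of_cycleEig_one_rat hn hs
      omega
    · exact Or.inr (Or.inr hs)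
  by_cases hx0 : cycleEig n 1 = 0
  · exact Or.inl ⟨0, by simpa using hx0⟩
  obtain ⟨q, hq⟩ := exists_rat_mul_of_mul_eq_rat_mul_pi ht hx0 (hj 2 h2) hx
  rw [cycleEig_two] at hq
  by_cases hb3 : 3 * (b : ℕ) = n
  -- The index 3 is lost and 4 replaces it. Substituting `x² = qx + 2` into `θ_4 = px` gives a
  -- linear equation for `x`; if it degenerates, `q = ±1` and the quadratic has integer roots.
  · left
    have hb3' : 3 * ((b : ℕ) : ℤ) = n := by exact_mod_cast hb3
    have h4 : ¬ (n : ℤ) ∣ 4 * (b : ℕ) := fun hd => by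
      have h5 : (n : ℤ) ∣ (b : ℕ) := by
        have : ((b : ℕ) : ℤ) = 4 * (b : ℕ) - n := by linarith
        rw [this]
        exact dvd_sub hd dvd_rfl
      have := Int.le_of_dvd (by omega) h5
      omega
    obtain ⟨p, hp⟩ := exists_rat_mul_of_mul_eq_rat_mul_pi ht hx0 (hj 4 h4) hx
    rw [cycleEig_four, hq] at hp
    set x := cycleEig n 1
    have hp' : x * (q ^ 3 - p) = 2 - 2 * q ^ 2 := by
      linear_combination hp - q ^ 2 * hq
    by_cases h0 : (q : ℝ) ^ 3 - p = 0
    · rw [h0, mul_zero] at hp'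
      have h5 : ((q : ℝ) - 1) * (q + 1) = 0 := by linarith
      rcases mul_eq_zero.mp h5 with h6 | h6
      · have h7 : (x - 2) * (x + 1) = 0 := by linear_combination hq + x * h6
        rcases mul_eq_zero.mp h7 with h8 | h8
        · exact ⟨2, by push_cast; linarith⟩
        · exact ⟨-1, by push_cast; linarith⟩
      · have h7 : (x + 2) * (x - 1) = 0 := by linear_combination hq + x * h6
        rcases mul_eq_zero.mp h7 with h8 | h8
        · exact ⟨-2, by push_cast; linarith⟩
        · exact ⟨1, by push_cast; linarith⟩
    · refine ⟨(2 - 2 * q ^ 2) / (q ^ 3 - p), ?_⟩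
      push_cast
      rw [eq_div_iff h0, hp']
  · have hb3' : 3 * ((b : ℕ) : ℤ) ≠ n := by exact_mod_cast hb3
    have h3 : ¬ (n : ℤ) ∣ 3 * (b : ℕ) := by
      rintro ⟨k, hk⟩
      have h4 : k < 2 := by nlinarith
      have h5 : 0 < k := by nlinarith
      obtain rfl : k = 1 := by omega
      omega
    obtain ⟨p, hp⟩ := exists_rat_mul_of_mul_eq_rat_mul_pi ht hx0 (hj 3 h3) hx
    rw [cycleEig_three] at hp
    have hp' : cycleEig n 1 ^ 2 = p + 3 := mul_left_cancel₀ hx0 (by linear_combination hp)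
    -- Here `qx = x² - 2 = p + 1` determines `x` unless `q = 0`. In that case `θ_2 = 0`, which means
    -- `n = 8`.
    by_cases hq0 : (q : ℝ) = 0
    · rw [hq0, zero_mul, ← cycleEig_two] at hq
      have hcos : Real.cos (2 * Real.pi * (2 : ℕ) / n) = 0 := by
        unfold cycleEig at hq
        push_cast at hq ⊢
        linarith
      have hn' : (0 : ℝ) < n := by exact_mod_cast (by omega : 0 < n)
      have h4n : (4 : ℝ) ≤ n := by exact_mod_cast hn
      have hπ := Real.pi_pos
      have hπ0 := hπ.ne'
      have h8 := Real.injOn_cos (x₁ := 2 * Real.pi * (2 : ℕ) / n) (x₂ := Real.pi / 2)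
        ⟨by positivity, by rw [div_le_iff₀ hn']; push_cast; nlinarith⟩
        ⟨by positivity, by linarith⟩ (by rw [hcos, Real.cos_pi_div_two])
      field_simp at h8
      have h8' : n = 8 := by
        have : (n : ℝ) = 8 := by push_cast at h8; linarith
        exact_mod_cast this
      by_cases hb2 : (b : ℕ) = 2
      · exact Or.inr ⟨h8', hb2⟩
      left
      -- For `n = 8` and `b ≠ 2` the index 4 is in the support, and `θ_4 = -2` is a rational
      -- multiple of `θ_1`.
      have h4 : ¬ (n : ℤ) ∣ 4 * (b : ℕ) := by
        rw [show (n : ℤ) = 8 by exact_mod_cast h8']; omega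
      obtain ⟨r, hr⟩ := exists_rat_mul_of_mul_eq_rat_mul_pi ht hx0 (hj 4 h4) hx
      rw [cycleEig_four, ← cycleEig_two, hq] at hr
      have hr0 : (r : ℝ) ≠ 0 := by
        intro h; rw [h] at hr; norm_num at hr
      refine ⟨-2 / r, ?_⟩
      push_cast
      rw [eq_div_iff hr0]
      linarith
    · left
      refine ⟨(p + 1) / q, ?_⟩
      push_cast
      rw [eq_div_iff hq0]
      linarith

end Size

/-! ### Reduction modulo `n`, phases and lower bounds for the time -/

section Periodicity

variable {n : ℕ}

lemma cycleChar_natCast (j : ℕ) (a : Fin n) :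
    cycleChar n j a = Complex.exp (2 * Real.pi * Complex.I / n) ^ (j * (a : ℕ)) := by
  rw [← Complex.exp_nat_mul, cycleChar]
  congr 1
  push_cast
  ring

lemma cycleChar_emod [NeZero n] (j : ℤ) (a : Fin n) : cycleChar n (j % n) a = cycleChar n j a := by
  have hn : (n : ℂ) ≠ 0 := by exact_mod_cast NeZero.ne n
  unfold cycleChar
  rw [Complex.exp_eq_exp_iff_exists_int]
  refine ⟨-(j / n * (a : ℕ)), ?_⟩
  rw [Int.emod_def]
  push_cast
  field_simp
  ring

lemma cycleEig_emod [NeZero n] (j : ℤ) : cycleEig n (j % n) = cycleEig n j := by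
  have hn : (n : ℝ) ≠ 0 := by exact_mod_cast NeZero.ne n
  unfold cycleEig
  rw [Int.emod_def, ← Real.cos_sub_int_mul_two_pi (2 * Real.pi * j / n) (j / n)]
  congr 2
  push_cast
  field_simp

lemma cycleTransferAt_of_forall_lt [NeZero n] {a b α β : Fin n} {s t : ℝ} (η : ℂ) (hη : ‖η‖ = 1)
    (h : ∀ j : ℕ, j < n →
      Complex.exp (-(Complex.I * t) * cycleEig n j) * (cycleChar n j a + s * cycleChar n j b)
        = η * (cycleChar n j α + s * cycleChar n j β)) : CycleTransferAt n a b α β s t := by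
  refine ⟨η, hη, fun j => ?_⟩
  have hn : (n : ℤ) ≠ 0 := by exact_mod_cast NeZero.ne n
  have h0 := Int.emod_nonneg j hn
  have h1 := Int.emod_lt_of_pos j (show (0 : ℤ) < n by have := NeZero.pos n; omega)
  obtain ⟨k, hk⟩ := Int.eq_ofNat_of_zero_le h0
  have := h k (by omega)
  rw [← hk] at this
  simpa only [cycleChar_emod, cycleEig_emod] using this

/-- A translation of `u` is a transfer as soon as the phases agree on the support of `u`. -/
lemma cycleTransferAt_add_of_phase [NeZero n] {b α : Fin n} {s t : ℝ} (η : ℂ) (hη : ‖η‖ = 1)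
    (h : ∀ j : ℕ, j < n → 1 + s * cycleChar n j b = 0 ∨
      Complex.exp (-(Complex.I * t) * cycleEig n j) = η * cycleChar n j α) :
    CycleTransferAt n 0 b α (α + b) s t := by
  refine cycleTransferAt_of_forall_lt η hη fun j hj => ?_
  rw [cycleChar_zero, cycleChar_add]
  rcases h j hj with h | h
  · linear_combination (Complex.exp (-(Complex.I * t) * cycleEig n j) - η * cycleChar n j α) * h
  · rw [h]; ring

lemma CycleTransferAt.exists_phase [NeZero n] {b α : Fin n} {s t : ℝ}
    (h : CycleTransferAt n 0 b α (α + b) s t) :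
    ∃ η : ℂ, ‖η‖ = 1 ∧ ∀ j : ℤ, cycleChar n j 0 + s * cycleChar n j b ≠ 0 →
      Complex.exp (-(Complex.I * t) * cycleEig n j) = η * cycleChar n j α := by
  obtain ⟨η, hη, h⟩ := h
  refine ⟨η, hη, fun j hj => mul_right_cancel₀ hj ?_⟩
  rw [h j, cycleChar_add, cycleChar_zero]
  ring

/-- A relative sign between two components of `u` takes time `π / (θ_k - θ_j)`. -/
lemma CycleTransferAt.pi_le {a b α β : Fin n} {s t : ℝ}
    (h : CycleTransferAt n a b α β s t) (ht : 0 < t) {j k : ℤ}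
    (hjk : cycleEig n j < cycleEig n k)
    (hsign : (cycleChar n j a + s * cycleChar n j b) * (cycleChar n k α + s * cycleChar n k β)
      = -((cycleChar n k a + s * cycleChar n k b) * (cycleChar n j α + s * cycleChar n j β)))
    (h0 : (cycleChar n k a + s * cycleChar n k b) * (cycleChar n j α + s * cycleChar n j β) ≠ 0) :
    Real.pi ≤ t * (cycleEig n k - cycleEig n j) := by
  obtain ⟨η, hη, h⟩ := h
  have h1 := h j
  have h2 := h k
  have h3 : Complex.exp (-(Complex.I * t) * cycleEig n j)
      = -Complex.exp (-(Complex.I * t) * cycleEig n k) := by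
    refine mul_right_cancel₀ h0 ?_
    linear_combination (cycleChar n j α + s * cycleChar n j β) * h2
      - (cycleChar n k α + s * cycleChar n k β) * h1
      + Complex.exp (-(Complex.I * t) * cycleEig n j) * hsign
  rw [← neg_one_mul (Complex.exp _), ← Complex.exp_pi_mul_I, ← Complex.exp_add,
    Complex.exp_eq_exp_iff_exists_int] at h3
  obtain ⟨z, hz⟩ := h3
  have h4 : ((t * (cycleEig n k - cycleEig n j) : ℝ) : ℂ) = (((2 * z + 1) * Real.pi : ℝ) : ℂ) := by
    refine mul_left_cancel₀ Complex.I_ne_zero ?_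
    push_cast
    linear_combination hz
  have h5 : t * (cycleEig n k - cycleEig n j) = (2 * z + 1) * Real.pi := by exact_mod_cast h4
  have h6 : 0 < (2 * z + 1) * Real.pi := by
    rw [← h5]; exact mul_pos ht (by linarith)
  have h7 : (0 : ℝ) < 2 * z + 1 := pos_of_mul_pos_left h6 Real.pi_pos.le
  have h8 : 0 ≤ z := by
    have : (0 : ℤ) < 2 * z + 1 := by exact_mod_cast h7
    omega
  have h9 : (0 : ℝ) ≤ z := by exact_mod_cast h8
  rw [h5]
  nlinarith [Real.pi_pos]

lemma exp_neg_I_mul_of_eq_two_mul_pi {t x : ℝ} (k : ℤ) (h : t * x = k * (2 * Real.pi)) :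
    Complex.exp (-(Complex.I * t) * x) = 1 := by
  rw [Complex.exp_eq_one_iff]
  refine ⟨-k, ?_⟩
  have : (t : ℂ) * x = k * (2 * Real.pi) := by exact_mod_cast h
  push_cast
  linear_combination -Complex.I * this

lemma exp_neg_I_mul_of_eq_pi {t x : ℝ} (k : ℤ) (h : t * x = Real.pi + k * (2 * Real.pi)) :
    Complex.exp (-(Complex.I * t) * x) = -1 := by
  rw [← Complex.exp_pi_mul_I, Complex.exp_eq_exp_iff_exists_int]
  refine ⟨-k - 1, ?_⟩
  have : (t : ℂ) * x = Real.pi + k * (2 * Real.pi) := by exact_mod_cast h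
  push_cast
  linear_combination -Complex.I * this

lemma exp_neg_I_mul_of_eq_pi_div_two {t x : ℝ} (h : t * x = Real.pi / 2) :
    Complex.exp (-(Complex.I * t) * x) = -Complex.I := by
  have : (t : ℂ) * x = Real.pi / 2 := by exact_mod_cast h
  rw [show -(Complex.I * t) * x = -(Real.pi / 2 * Complex.I) by
    linear_combination -Complex.I * this, Complex.exp_neg, Complex.exp_pi_div_two_mul_I,
    Complex.inv_I]

lemma exp_neg_I_mul_of_eq_neg_pi_div_two {t x : ℝ} (h : t * x = -(Real.pi / 2)) :
    Complex.exp (-(Complex.I * t) * x) = Complex.I := by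
  have : (t : ℂ) * x = -(Real.pi / 2) := by exact_mod_cast h
  rw [show -(Complex.I * t) * x = (Real.pi / 2 * Complex.I) by
    linear_combination -Complex.I * this, Complex.exp_pi_div_two_mul_I]

end Periodicity

/-! ### Eigenvalues and roots of unity for n = 4, 6, 8, 12 -/

section SmallCycles

lemma cycleEig_four_values :
    cycleEig 4 0 = 2 ∧ cycleEig 4 1 = 0 ∧ cycleEig 4 2 = -2 ∧ cycleEig 4 3 = 0 := by
  have h1 : cycleEig 4 1 = 0 := by
    rw [cycleEig_one]
    rw [show 2 * Real.pi / (4 : ℕ) = Real.pi / 2 by push_cast; ring, Real.cos_pi_div_two, mul_zero]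
  refine ⟨cycleEig_zero, h1, ?_, ?_⟩
  · rw [cycleEig_two, h1]; norm_num
  · rw [cycleEig_three, h1]; norm_num

lemma cycleEig_six_values :
    cycleEig 6 0 = 2 ∧ cycleEig 6 1 = 1 ∧ cycleEig 6 2 = -1 ∧ cycleEig 6 3 = -2 ∧
      cycleEig 6 4 = -1 ∧ cycleEig 6 5 = 1 := by
  have h1 : cycleEig 6 1 = 1 := by
    rw [cycleEig_one]
    rw [show 2 * Real.pi / (6 : ℕ) = Real.pi / 3 by push_cast; ring, Real.cos_pi_div_three]
    norm_num
  refine ⟨cycleEig_zero, h1, ?_, ?_, ?_, ?_⟩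
  · rw [cycleEig_two, h1]; norm_num
  · rw [cycleEig_three, h1]; norm_num
  · rw [cycleEig_four, h1]; norm_num
  · rw [← h1, ← cycleEig_neg 1, ← cycleEig_emod (-1)]; norm_num

lemma cycleEig_eight_values :
    cycleEig 8 0 = 2 ∧ cycleEig 8 1 = √2 ∧ cycleEig 8 2 = 0 ∧ cycleEig 8 3 = -√2 ∧
      cycleEig 8 4 = -2 ∧ cycleEig 8 5 = -√2 ∧ cycleEig 8 6 = 0 ∧ cycleEig 8 7 = √2 := by
  have h1 : cycleEig 8 1 = √2 := by
    rw [cycleEig_one]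
    rw [show 2 * Real.pi / (8 : ℕ) = Real.pi / 4 by push_cast; ring, Real.cos_pi_div_four]
    ring
  have hs : √2 ^ 2 = (2 : ℝ) := Real.sq_sqrt (by norm_num)
  have h2 : cycleEig 8 2 = 0 := by rw [cycleEig_two, h1, hs]; norm_num
  have h3 : cycleEig 8 3 = -√2 := by
    rw [cycleEig_three, h1]; linear_combination √2 * hs
  refine ⟨cycleEig_zero, h1, h2, h3, ?_, ?_, ?_, ?_⟩
  · rw [cycleEig_four, h1, hs]; norm_num
  · rw [← h3, ← cycleEig_neg 3, ← cycleEig_emod (-3)]; norm_num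
  · rw [← h2, ← cycleEig_neg 2, ← cycleEig_emod (-2)]; norm_num
  · rw [← h1, ← cycleEig_neg 1, ← cycleEig_emod (-1)]; norm_num

/-- Only even indices occur in the support of `e_0 + e_6`, and these three suffice for a
contradiction. -/
lemma cycleEig_twelve_values :
    cycleEig 12 0 = 2 ∧ cycleEig 12 2 = 1 ∧ cycleEig 12 4 = -1 := by
  have h1 : cycleEig 12 2 = 1 := by
    unfold cycleEig
    rw [show 2 * Real.pi * ((2 : ℤ) : ℝ) / (12 : ℕ) = Real.pi / 3 by push_cast; ring,
      Real.cos_pi_div_three]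
    norm_num
  refine ⟨cycleEig_zero, h1, ?_⟩
  rw [show (4 : ℤ) = 2 * 2 by norm_num, cycleEig_two_mul, h1]; norm_num

lemma exp_two_pi_I_div_four : Complex.exp (2 * Real.pi * Complex.I / (4 : ℕ)) = Complex.I := by
  refine Eq.trans ?_ Complex.exp_pi_div_two_mul_I
  congr 1; push_cast; ring

/-- The sixth cyclotomic relation, obtained by cancelling `ω + 1` from `ω³ + 1 = 0`. All
computations for `n = 6` reduce powers of `ω` by it. -/
lemma exp_two_pi_I_div_six_sq : Complex.exp (2 * Real.pi * Complex.I / (6 : ℕ)) ^ 2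
    = Complex.exp (2 * Real.pi * Complex.I / (6 : ℕ)) - 1 := by
  have h : Complex.exp (2 * Real.pi * Complex.I / (6 : ℕ)) ^ 3 = -1 := by
    rw [← Complex.exp_pi_mul_I, ← Complex.exp_nat_mul]; congr 1; push_cast; ring
  have h1 : Complex.exp (2 * Real.pi * Complex.I / (6 : ℕ)) ≠ -1 := by
    have h := (Complex.isPrimitiveRoot_exp 6 (by norm_num)).pow_ne_one_of_pos_of_lt
      (l := 2) (by norm_num) (by norm_num)
    intro h2
    rw [h2] at h
    norm_num at h
  have h2 : Complex.exp (2 * Real.pi * Complex.I / (6 : ℕ)) + 1 ≠ 0 :=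
    fun h => h1 (eq_neg_of_add_eq_zero_left h)
  refine mul_left_cancel₀ h2 ?_
  linear_combination h

lemma exp_two_pi_I_div_eight_sq :
    Complex.exp (2 * Real.pi * Complex.I / (8 : ℕ)) ^ 2 = Complex.I := by
  refine Eq.trans ?_ Complex.exp_pi_div_two_mul_I
  rw [← Complex.exp_nat_mul]; congr 1; push_cast; ring

end SmallCycles

/-! ### The listed transfers occur -/

section Transfers

variable {s : ℝ}

/-- At time `π/2` the phases are -1, 1, -1, 1, that is `-χ_j(2)` for every `j`: the walk translates
every state by 2, whatever `s` is. -/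
lemma cycleTransferAt_four_adjacent :
    CycleTransferAt 4 0 1 2 3 s (Real.pi / 2) := by
  obtain ⟨e0, e1, e2, e3⟩ := cycleEig_four_values
  refine cycleTransferAt_add_of_phase (b := 1) (α := 2) (-1) (by simp) fun j hj => Or.inr ?_
  rw [cycleChar_natCast, exp_two_pi_I_div_four]
  interval_cases j
  · rw [exp_neg_I_mul_of_eq_pi 0 (by push_cast; rw [e0]; ring)]; simp
  · rw [exp_neg_I_mul_of_eq_two_mul_pi 0 (by push_cast; rw [e1]; ring)]; simp
  · rw [exp_neg_I_mul_of_eq_pi (-1) (by push_cast; rw [e2]; ring)]; simp [pow_succ]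
  · rw [exp_neg_I_mul_of_eq_two_mul_pi 0 (by push_cast; rw [e3]; ring)]; simp [pow_succ]

lemma cycleTransferAt_four_swap :
    CycleTransferAt 4 0 2 2 0 s (Real.pi / 2) := by
  obtain ⟨e0, e1, e2, e3⟩ := cycleEig_four_values
  refine cycleTransferAt_add_of_phase (b := 2) (α := 2) (-1) (by simp) fun j hj => Or.inr ?_
  rw [cycleChar_natCast, exp_two_pi_I_div_four]
  interval_cases j
  · rw [exp_neg_I_mul_of_eq_pi 0 (by push_cast; rw [e0]; ring)]; simp
  · rw [exp_neg_I_mul_of_eq_two_mul_pi 0 (by push_cast; rw [e1]; ring)]; simp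
  · rw [exp_neg_I_mul_of_eq_pi (-1) (by push_cast; rw [e2]; ring)]; simp [pow_succ]
  · rw [exp_neg_I_mul_of_eq_two_mul_pi 0 (by push_cast; rw [e3]; ring)]; simp [pow_succ]

/-- Only `j = 0, 2` survive, so half the time of the full translation is enough. -/
lemma cycleTransferAt_four_antipodal :
    CycleTransferAt 4 0 2 1 3 ((1 : ℝ)) (Real.pi / 4) := by
  obtain ⟨e0, e1, e2, e3⟩ := cycleEig_four_values
  refine cycleTransferAt_add_of_phase (b := 2) (α := 1) (-Complex.I) (by simp) fun j hj => ?_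
  rw [cycleChar_natCast, cycleChar_natCast, exp_two_pi_I_div_four]
  interval_cases j
  · right
    rw [exp_neg_I_mul_of_eq_pi_div_two (by push_cast; rw [e0]; ring)]; simp
  · left; simp
  · right
    rw [exp_neg_I_mul_of_eq_neg_pi_div_two (by push_cast; rw [e2]; ring)]; simp
  · left; simp [pow_succ]

lemma cycleTransferAt_six_neg_one :
    CycleTransferAt 6 0 2 3 5 ((-1 : ℝ)) (Real.pi / 2) := by
  obtain ⟨e0, e1, e2, e3, e4, e5⟩ := cycleEig_six_values
  have hω := exp_two_pi_I_div_six_sq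
  refine cycleTransferAt_add_of_phase (b := 2) (α := 3) Complex.I (by simp) fun j hj => ?_
  rw [cycleChar_natCast, cycleChar_natCast]
  set ω := Complex.exp (2 * Real.pi * Complex.I / (6 : ℕ))
  have h3 : ω ^ 3 = -1 := by linear_combination (ω + 1) * hω
  have h6 : ω ^ 6 = 1 := by linear_combination (ω ^ 3 - 1) * h3
  have h9 : ω ^ 9 = -1 := by linear_combination h3 + ω ^ 3 * h6
  have h12 : ω ^ 12 = 1 := by linear_combination (ω ^ 6 + 1) * h6
  have h15 : ω ^ 15 = -1 := by linear_combination h9 + ω ^ 9 * h6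
  interval_cases j
  · left; simp
  · right
    rw [exp_neg_I_mul_of_eq_pi_div_two (by push_cast; rw [e1]; ring)]; simp [h3]
  · right
    rw [exp_neg_I_mul_of_eq_neg_pi_div_two (by push_cast; rw [e2]; ring)]; simp [h6]
  · left; simp [h6]
  · right
    rw [exp_neg_I_mul_of_eq_neg_pi_div_two (by push_cast; rw [e4]; ring)]; simp [h12]
  · right
    rw [exp_neg_I_mul_of_eq_pi_div_two (by push_cast; rw [e5]; ring)]; simp [h15]

/-- The target is the reflection of the source, so `g_j` is the conjugate of `f_j`. The value `1 +
2ω^(2j)` is real for `j` divisible by 3 and purely imaginary otherwise, which matches the phases 1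
and -1 at time `π`. -/
lemma cycleTransferAt_six_two :
    CycleTransferAt 6 0 2 0 4 ((2 : ℝ)) Real.pi := by
  obtain ⟨e0, e1, e2, e3, e4, e5⟩ := cycleEig_six_values
  have hω := exp_two_pi_I_div_six_sq
  refine cycleTransferAt_of_forall_lt 1 (by simp) fun j hj => ?_
  rw [cycleChar_zero, cycleChar_natCast, cycleChar_natCast]
  set ω := Complex.exp (2 * Real.pi * Complex.I / (6 : ℕ))
  have h3 : ω ^ 3 = -1 := by linear_combination (ω + 1) * hω
  have h6 : ω ^ 6 = 1 := by linear_combination (ω ^ 3 - 1) * h3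
  have h12 : ω ^ 12 = 1 := by linear_combination (ω ^ 6 + 1) * h6
  have h4 : ω ^ 4 = -ω := by linear_combination ω * h3
  have h8 : ω ^ 8 = ω - 1 := by linear_combination ω ^ 2 * h6 + hω
  have h10 : ω ^ 10 = -ω := by linear_combination h4 + ω ^ 4 * h6
  have h16 : ω ^ 16 = -ω := by linear_combination h10 + ω ^ 10 * h6
  have h20 : ω ^ 20 = ω - 1 := by linear_combination h8 + ω ^ 8 * h12
  interval_cases j
  · rw [exp_neg_I_mul_of_eq_two_mul_pi 1 (by push_cast; rw [e0]; ring)]; simp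
  · rw [exp_neg_I_mul_of_eq_pi 0 (by push_cast; rw [e1]; ring)]; simp [hω, h4]; ring
  · rw [exp_neg_I_mul_of_eq_pi (-1) (by push_cast; rw [e2]; ring)]; simp [h4, h8]; ring
  · rw [exp_neg_I_mul_of_eq_two_mul_pi (-1) (by push_cast; rw [e3]; ring)]; simp [h6, h12]
  · rw [exp_neg_I_mul_of_eq_pi (-1) (by push_cast; rw [e4]; ring)]; simp [h8, h16]; ring
  · rw [exp_neg_I_mul_of_eq_pi 0 (by push_cast; rw [e5]; ring)]; simp [h10, h20]; ring

/-- Up to normalization this is the image of the transfer for `s = 2` under the automorphism `x ↦ 2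
- x`. -/
lemma cycleTransferAt_six_half :
    CycleTransferAt 6 0 2 4 2 ((1 / 2 : ℝ)) Real.pi := by
  obtain ⟨e0, e1, e2, e3, e4, e5⟩ := cycleEig_six_values
  have hω := exp_two_pi_I_div_six_sq
  refine cycleTransferAt_of_forall_lt 1 (by simp) fun j hj => ?_
  rw [cycleChar_zero, cycleChar_natCast, cycleChar_natCast]
  set ω := Complex.exp (2 * Real.pi * Complex.I / (6 : ℕ))
  have h3 : ω ^ 3 = -1 := by linear_combination (ω + 1) * hω
  have h6 : ω ^ 6 = 1 := by linear_combination (ω ^ 3 - 1) * h3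
  have h12 : ω ^ 12 = 1 := by linear_combination (ω ^ 6 + 1) * h6
  have h4 : ω ^ 4 = -ω := by linear_combination ω * h3
  have h8 : ω ^ 8 = ω - 1 := by linear_combination ω ^ 2 * h6 + hω
  have h10 : ω ^ 10 = -ω := by linear_combination h4 + ω ^ 4 * h6
  have h16 : ω ^ 16 = -ω := by linear_combination h10 + ω ^ 10 * h6
  have h20 : ω ^ 20 = ω - 1 := by linear_combination h8 + ω ^ 8 * h12
  interval_cases j
  · rw [exp_neg_I_mul_of_eq_two_mul_pi 1 (by push_cast; rw [e0]; ring)]; simp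
  · rw [exp_neg_I_mul_of_eq_pi 0 (by push_cast; rw [e1]; ring)]; simp [hω, h4]; ring
  · rw [exp_neg_I_mul_of_eq_pi (-1) (by push_cast; rw [e2]; ring)]; simp [h4, h8]; ring
  · rw [exp_neg_I_mul_of_eq_two_mul_pi (-1) (by push_cast; rw [e3]; ring)]; simp [h6, h12]
  · rw [exp_neg_I_mul_of_eq_pi (-1) (by push_cast; rw [e4]; ring)]; simp [h8, h16]; ring
  · rw [exp_neg_I_mul_of_eq_pi 0 (by push_cast; rw [e5]; ring)]; simp [h10, h20]; ring

/-- The indices 0 and 4 are lost, so only the eigenvalues 0 and `±√2` remain and the walk becomes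
periodic. -/
lemma cycleTransferAt_eight_neg_one :
    CycleTransferAt 8 0 2 4 6 ((-1 : ℝ)) (Real.pi / √2) := by
  obtain ⟨e0, e1, e2, e3, e4, e5, e6, e7⟩ := cycleEig_eight_values
  have hω := exp_two_pi_I_div_eight_sq
  have hs : (√2 : ℝ) ≠ 0 := by positivity
  refine cycleTransferAt_add_of_phase (b := 2) (α := 4) 1 (by simp) fun j hj => ?_
  rw [cycleChar_natCast, cycleChar_natCast]
  set ω := Complex.exp (2 * Real.pi * Complex.I / (8 : ℕ))
  have h4 : ω ^ 4 = -1 := by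
    linear_combination (ω ^ 2 + Complex.I) * hω + Complex.I_sq
  have h8 : ω ^ 8 = 1 := by linear_combination (ω ^ 4 - 1) * h4
  have h12 : ω ^ 12 = -1 := by linear_combination h4 + ω ^ 4 * h8
  have h20 : ω ^ 20 = -1 := by linear_combination h12 + ω ^ 12 * h8
  have h24 : ω ^ 24 = 1 := by linear_combination (ω ^ 16 + ω ^ 8 + 1) * h8
  have h28 : ω ^ 28 = -1 := by linear_combination h20 + ω ^ 20 * h8
  interval_cases j
  · left; simp
  · right
    rw [exp_neg_I_mul_of_eq_pi 0 (by push_cast; rw [e1]; field_simp; ring)]; simp [h4]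
  · right
    rw [exp_neg_I_mul_of_eq_two_mul_pi 0 (by push_cast; rw [e2]; ring)]; simp [h8]
  · right
    rw [exp_neg_I_mul_of_eq_pi (-1) (by push_cast; rw [e3]; field_simp; ring)]; simp [h12]
  · left; simp [h8]
  · right
    rw [exp_neg_I_mul_of_eq_pi (-1) (by push_cast; rw [e5]; field_simp; ring)]; simp [h20]
  · right
    rw [exp_neg_I_mul_of_eq_two_mul_pi 0 (by push_cast; rw [e6]; ring)]; simp [h24]
  · right
    rw [exp_neg_I_mul_of_eq_pi 0 (by push_cast; rw [e7]; field_simp; ring)]; simp [h28]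

lemma cycleTransferAt_eight_antipodal :
    CycleTransferAt 8 0 4 2 6 ((1 : ℝ)) (Real.pi / 2) := by
  obtain ⟨e0, e1, e2, e3, e4, e5, e6, e7⟩ := cycleEig_eight_values
  have hω := exp_two_pi_I_div_eight_sq
  refine cycleTransferAt_add_of_phase (b := 4) (α := 2) (-1) (by simp) fun j hj => ?_
  rw [cycleChar_natCast, cycleChar_natCast]
  set ω := Complex.exp (2 * Real.pi * Complex.I / (8 : ℕ))
  have h4 : ω ^ 4 = -1 := by
    linear_combination (ω ^ 2 + Complex.I) * hω + Complex.I_sq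
  have h8 : ω ^ 8 = 1 := by linear_combination (ω ^ 4 - 1) * h4
  have h12 : ω ^ 12 = -1 := by linear_combination h4 + ω ^ 4 * h8
  have h20 : ω ^ 20 = -1 := by linear_combination h12 + ω ^ 12 * h8
  have h28 : ω ^ 28 = -1 := by linear_combination h20 + ω ^ 20 * h8
  interval_cases j
  · right
    rw [exp_neg_I_mul_of_eq_pi 0 (by push_cast; rw [e0]; ring)]; simp
  · left; simp [h4]
  · right
    rw [exp_neg_I_mul_of_eq_two_mul_pi 0 (by push_cast; rw [e2]; ring)]; simp [h4]
  · left; simp [h12]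
  · right
    rw [exp_neg_I_mul_of_eq_pi (-1) (by push_cast; rw [e4]; ring)]; simp [h8]
  · left; simp [h20]
  · right
    rw [exp_neg_I_mul_of_eq_two_mul_pi 0 (by push_cast; rw [e6]; ring)]; simp [h12]
  · left; simp [h28]

end Transfers

/-! ### The listed times are minimal -/

section MinimalTimes

variable {s t : ℝ}

lemma CycleTransferAt.le_four_adjacent (h : CycleTransferAt 4 0 1 2 3 s t) (ht : 0 < t) :
    Real.pi / 2 ≤ t := by
  obtain ⟨e0, e1, e2, e3⟩ := cycleEig_four_values
  have c : ∀ (j : ℕ) (a : Fin 4), cycleChar 4 j a = Complex.I ^ (j * (a : ℕ)) := fun j a => by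
    rw [cycleChar_natCast, exp_two_pi_I_div_four]
  have I2 := Complex.I_sq
  have I3 : Complex.I ^ 3 = -Complex.I := Complex.I_pow_three
  have I4 : Complex.I ^ 4 = 1 := Complex.I_pow_four
  have I6 : Complex.I ^ 6 = -1 := by linear_combination Complex.I ^ 2 * I4 + I2
  -- For `s = -1` the index 0 is lost and the pair 2, 1 replaces 1, 0; the eigenvalue gap is 2
  -- either way.
  by_cases hs : s = -1
  · subst hs
    have := h.pi_le ht (j := (2 : ℕ)) (k := (1 : ℕ)) (by push_cast; rw [e1, e2]; norm_num)
      (by simp only [c]; simp [I2, I3, I4, I6]; ring)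
      (by
        simp only [c]; simp [I4, I6]
        intro h
        have := congrArg Complex.re h
        norm_num at this)
    push_cast at this
    rw [e1, e2] at this
    linarith
  · have hs' : (1 : ℂ) + s ≠ 0 := by
      intro h
      apply hs
      have := congrArg Complex.re h
      simp at this
      linarith
    have := h.pi_le ht (j := (1 : ℕ)) (k := (0 : ℕ)) (by push_cast; rw [e0, e1]; norm_num)
      (by simp only [c]; simp [I2, I3]; ring)
      (by
        simp only [c]; simp [I2, I3]
        refine ⟨hs', fun h => ?_⟩
        have := congrArg Complex.re h
        norm_num at this)
    push_cast at this
    rw [e0, e1] at this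
    linarith

lemma CycleTransferAt.le_four_swap (h : CycleTransferAt 4 0 2 2 0 s t) (hs : s ≠ -1)
    (hs1 : s ≠ 1) (ht : 0 < t) : Real.pi / 2 ≤ t := by
  obtain ⟨e0, e1, e2, e3⟩ := cycleEig_four_values
  have c : ∀ (j : ℕ) (a : Fin 4), cycleChar 4 j a = Complex.I ^ (j * (a : ℕ)) := fun j a => by
    rw [cycleChar_natCast, exp_two_pi_I_div_four]
  have hs' : (1 : ℂ) + s ≠ 0 := fun h => hs (by
    have : (1 : ℝ) + s = 0 := by exact_mod_cast h
    linarith)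
  have hs1' : (s : ℂ) - 1 ≠ 0 := fun h => hs1 (by
    have : s - (1 : ℝ) = 0 := by exact_mod_cast h
    linarith)
  have := h.pi_le ht (j := (1 : ℕ)) (k := (0 : ℕ)) (by push_cast; rw [e0, e1]; norm_num)
    (by simp only [c]; simp; ring)
    (by
      simp only [c]; simp
      exact ⟨hs', fun h => hs1' (by linear_combination h)⟩)
  push_cast at this
  rw [e0, e1] at this
  linarith

lemma CycleTransferAt.le_four_antipodal (h : CycleTransferAt 4 0 2 1 3 ((1 : ℝ)) t) (ht : 0 < t) :
    Real.pi / 4 ≤ t := by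
  obtain ⟨e0, e1, e2, e3⟩ := cycleEig_four_values
  have c : ∀ (j : ℕ) (a : Fin 4), cycleChar 4 j a = Complex.I ^ (j * (a : ℕ)) := fun j a => by
    rw [cycleChar_natCast, exp_two_pi_I_div_four]
  have I4 : Complex.I ^ 4 = 1 := Complex.I_pow_four
  have I6 : Complex.I ^ 6 = -1 := by
    linear_combination Complex.I ^ 2 * I4 + Complex.I_sq
  have := h.pi_le ht (j := (2 : ℕ)) (k := (0 : ℕ)) (by push_cast; rw [e0, e2]; norm_num)
    (by simp only [c]; simp [I4, I6]; ring)
    (by simp only [c]; simp [I6])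
  push_cast at this
  rw [e0, e2] at this
  linarith

lemma CycleTransferAt.le_six_neg_one (h : CycleTransferAt 6 0 2 3 5 ((-1 : ℝ)) t) (ht : 0 < t) :
    Real.pi / 2 ≤ t := by
  obtain ⟨e0, e1, e2, e3, e4, e5⟩ := cycleEig_six_values
  have hω := exp_two_pi_I_div_six_sq
  have c := cycleChar_natCast (n := 6)
  set ω := Complex.exp (2 * Real.pi * Complex.I / (6 : ℕ))
  have h3 : ω ^ 3 = -1 := by linear_combination (ω + 1) * hω
  have h6 : ω ^ 6 = 1 := by linear_combination (ω ^ 3 - 1) * h3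
  have h4 : ω ^ 4 = -ω := by linear_combination ω * h3
  have h5 : ω ^ 5 = 1 - ω := by linear_combination ω * h4 - hω
  have h10 : ω ^ 10 = -ω := by linear_combination h4 + ω ^ 4 * h6
  have := h.pi_le ht (j := (2 : ℕ)) (k := (1 : ℕ)) (by push_cast; rw [e1, e2]; norm_num)
    (by simp only [c]; simp [h3, h6, h4, h5, h10, hω]; ring)
    (by
      simp only [c]; simp [h6, h10, hω]
      constructor
      · intro h0
        have h1 : ω = 2 := by linear_combination -h0
        rw [h1] at hω; norm_num at hω
      · intro h0
        have h1 : ω = -1 := by linear_combination h0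
        rw [h1] at hω; norm_num at hω)
  push_cast at this
  rw [e1, e2] at this
  linarith

lemma CycleTransferAt.le_six_two (h : CycleTransferAt 6 0 2 0 4 ((2 : ℝ)) t) (ht : 0 < t) :
    Real.pi ≤ t := by
  obtain ⟨e0, e1, e2, e3, e4, e5⟩ := cycleEig_six_values
  have hω := exp_two_pi_I_div_six_sq
  have c := cycleChar_natCast (n := 6)
  set ω := Complex.exp (2 * Real.pi * Complex.I / (6 : ℕ))
  have h4 : ω ^ 4 = -ω := by linear_combination (ω ^ 2 + ω) * hω
  have := h.pi_le ht (j := (1 : ℕ)) (k := (0 : ℕ)) (by push_cast; rw [e0, e1]; norm_num)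
    (by simp only [c]; simp [h4, hω]; ring)
    (by
      simp only [c]; simp [h4]
      constructor
      · norm_num
      · intro h0
        have h1 : ω = 1 / 2 := by linear_combination -h0 / 2
        rw [h1] at hω; norm_num at hω)
  push_cast at this
  rw [e0, e1] at this
  linarith

lemma CycleTransferAt.le_six_half (h : CycleTransferAt 6 0 2 4 2 ((1 / 2 : ℝ)) t) (ht : 0 < t) :
    Real.pi ≤ t := by
  obtain ⟨e0, e1, e2, e3, e4, e5⟩ := cycleEig_six_values
  have hω := exp_two_pi_I_div_six_sq
  have c := cycleChar_natCast (n := 6)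
  set ω := Complex.exp (2 * Real.pi * Complex.I / (6 : ℕ))
  have h4 : ω ^ 4 = -ω := by linear_combination (ω ^ 2 + ω) * hω
  have := h.pi_le ht (j := (1 : ℕ)) (k := (0 : ℕ)) (by push_cast; rw [e0, e1]; norm_num)
    (by simp only [c]; simp [h4, hω]; ring)
    (by
      simp only [c]; simp [h4, hω]
      constructor
      · norm_num
      · intro h0
        have h1 : ω = -1 := by linear_combination -2 * h0
        rw [h1] at hω; norm_num at hω)
  push_cast at this
  rw [e0, e1] at this
  linarith

lemma CycleTransferAt.le_eight_neg_one (h : CycleTransferAt 8 0 2 4 6 ((-1 : ℝ)) t)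
    (ht : 0 < t) : Real.pi / √2 ≤ t := by
  obtain ⟨e0, e1, e2, e3, e4, e5, e6, e7⟩ := cycleEig_eight_values
  have hω := exp_two_pi_I_div_eight_sq
  have c := cycleChar_natCast (n := 8)
  set ω := Complex.exp (2 * Real.pi * Complex.I / (8 : ℕ))
  have h4 : ω ^ 4 = -1 := by
    linear_combination (ω ^ 2 + Complex.I) * hω + Complex.I_sq
  have h6 : ω ^ 6 = -Complex.I := by linear_combination ω ^ 2 * h4 - hω
  have h8 : ω ^ 8 = 1 := by linear_combination (ω ^ 4 - 1) * h4
  have h12 : ω ^ 12 = -1 := by linear_combination h4 + ω ^ 4 * h8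
  have hs : (0 : ℝ) < √2 := by positivity
  have := h.pi_le ht (j := (2 : ℕ)) (k := (1 : ℕ)) (by push_cast; rw [e1, e2]; exact hs)
    (by simp only [c]; simp [h4, h6, h8, h12, hω]; ring)
    (by
      simp only [c]; simp [h8, h12, hω]
      intro h
      have := congrArg Complex.re h
      norm_num at this)
  push_cast at this
  rw [e1, e2, sub_zero] at this
  rwa [div_le_iff₀ hs]

lemma CycleTransferAt.le_eight_antipodal (h : CycleTransferAt 8 0 4 2 6 ((1 : ℝ)) t)
    (ht : 0 < t) : Real.pi / 2 ≤ t := by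
  obtain ⟨e0, e1, e2, e3, e4, e5, e6, e7⟩ := cycleEig_eight_values
  have hω := exp_two_pi_I_div_eight_sq
  have c := cycleChar_natCast (n := 8)
  set ω := Complex.exp (2 * Real.pi * Complex.I / (8 : ℕ))
  have h4 : ω ^ 4 = -1 := by
    linear_combination (ω ^ 2 + Complex.I) * hω + Complex.I_sq
  have h8 : ω ^ 8 = 1 := by linear_combination (ω ^ 4 - 1) * h4
  have h12 : ω ^ 12 = -1 := by linear_combination h4 + ω ^ 4 * h8
  have := h.pi_le ht (j := (2 : ℕ)) (k := (0 : ℕ)) (by push_cast; rw [e0, e2]; norm_num)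
    (by simp only [c]; simp [h4, h8, h12]; ring)
    (by simp only [c]; simp [h4, h12])
  push_cast at this
  rw [e0, e2] at this
  linarith

end MinimalTimes

/-! ### Elimination of the remaining candidates -/

section Classification

variable {n : ℕ} [NeZero n] {s t : ℝ} {b α β : Fin n}

omit [NeZero n] in
lemma sameState_pairState_swap (a b : Fin n) (hs : s ^ 2 = 1) :
    SameState (pairState a b (s : ℂ)) (pairState b a (s : ℂ)) := by
  rw [sameState_pairState_iff]
  have hs' : (s : ℂ) ^ 2 = 1 := by exact_mod_cast hs
  refine ⟨s, ?_, fun x => by linear_combination (-(if x = a then 1 else 0 : ℂ)) * hs'⟩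
  have h1 := congrArg norm hs'
  rw [norm_pow, norm_one] at h1
  exact (pow_eq_one_iff_of_nonneg (norm_nonneg _) two_ne_zero).mp h1

omit [NeZero n] in
lemma sameState_refl {V : Type*} (u : V → ℂ) : SameState u u := ⟨1, by simp, by simp⟩

/-- At time 0 the state has not moved. The rationality arguments need `t ≠ 0` in order to cancel
`t`. -/
lemma CycleTransferAt.ne_zero (h : CycleTransferAt n 0 b α β s t)
    (hne : ¬ SameState (pairState 0 b (s : ℂ)) (pairState α β (s : ℂ))) : t ≠ 0 := by
  rintro rfl
  apply hne
  obtain ⟨η, hη, h⟩ := h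
  refine ⟨η, hη, eq_of_forall_cycleChar_dotProduct _ _ fun j => ?_⟩
  rw [dotProduct_smul, cycleChar_dotProduct_pairState, cycleChar_dotProduct_pairState, smul_eq_mul]
  have := h (j : ℕ)
  simp only [Complex.ofReal_zero, mul_zero, neg_zero, zero_mul, Complex.exp_zero, one_mul] at this
  rw [this]
  ring

lemma two_mul_val_of_add_self_eq_zero (hα : α + α = 0) (h0 : α ≠ 0) : 2 * (α : ℕ) = n := by
  have h1 := congrArg Fin.val hα
  rw [Fin.val_add, Fin.val_zero] at h1
  have h2 := α.2
  have h3 : (α : ℕ) ≠ 0 := fun h => h0 (Fin.ext (by rw [h, Fin.val_zero]))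
  obtain ⟨k, hk⟩ := Nat.dvd_of_mod_eq_zero h1
  have h4 : k < 2 := by nlinarith
  have h5 : 0 < k := by
    rcases Nat.eq_zero_or_pos k with rfl | h
    · omega
    · exact h
  obtain rfl : k = 1 := by omega
  omega

lemma cycleChar_one_eq_neg_one (hα : α + α = 0) (h0 : α ≠ 0) : cycleChar n 1 α = -1 := by
  have h := two_mul_val_of_add_self_eq_zero hα h0
  have hn : (n : ℝ) ≠ 0 := by exact_mod_cast NeZero.ne n
  have h' : (n : ℝ) = 2 * (α : ℕ) := by exact_mod_cast h.symm
  rw [← Complex.exp_pi_mul_I, cycleChar]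
  congr 2
  have : 2 * Real.pi * (1 : ℤ) * (α : ℕ) / n = Real.pi := by
    rw [div_eq_iff hn, h']; push_cast; ring
  rw [this]

lemma cycleChar_eq_neg_one_pow (hα : α + α = 0) (h0 : α ≠ 0) (j : ℕ) :
    cycleChar n j α = (-1) ^ j := by
  have := cycleChar_mul_index 1 (j : ℤ) α
  rw [cycleChar_one_eq_neg_one hα h0, one_mul, zpow_natCast] at this
  exact this

lemma exp_neg_I_mul_ofReal_two (t : ℝ) :
    Complex.exp (-(Complex.I * t) * ((2 : ℝ) : ℂ))
      = Complex.exp (-(Complex.I * t) * ((1 : ℝ) : ℂ)) ^ 2 := by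
  rw [← Complex.exp_nat_mul]; congr 1; push_cast; ring

lemma exp_neg_I_mul_ofReal_neg_one (t : ℝ) :
    Complex.exp (-(Complex.I * t) * ((-1 : ℝ) : ℂ)) *
      Complex.exp (-(Complex.I * t) * ((1 : ℝ) : ℂ)) = 1 := by
  rw [← Complex.exp_add, ← Complex.exp_zero]; congr 1; push_cast; ring

lemma exp_neg_I_mul_ofReal_neg_two (t : ℝ) :
    Complex.exp (-(Complex.I * t) * ((-2 : ℝ) : ℂ)) *
      Complex.exp (-(Complex.I * t) * ((1 : ℝ) : ℂ)) ^ 2 = 1 := by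
  rw [← exp_neg_I_mul_ofReal_two, ← Complex.exp_add, ← Complex.exp_zero]
  congr 1; push_cast; ring

/-- The phases at the eigenvalues `2, 1, -1` cannot alternate in sign. -/
lemma not_alternating_phases {t : ℝ} {η : ℂ} (hη : ‖η‖ = 1)
    (h0 : Complex.exp (-(Complex.I * t) * ((2 : ℝ) : ℂ)) = η)
    (h1 : Complex.exp (-(Complex.I * t) * ((1 : ℝ) : ℂ)) = -η)
    (h2 : Complex.exp (-(Complex.I * t) * ((-1 : ℝ) : ℂ)) = η) : False := by
  have hη0 : η ≠ 0 := norm_ne_zero_iff.mp (by rw [hη]; exact one_ne_zero)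
  have h3 := exp_neg_I_mul_ofReal_two t
  have h4 := exp_neg_I_mul_ofReal_neg_one t
  rw [h0, h1] at h3
  rw [h1, h2] at h4
  have h5 : η = 1 := mul_left_cancel₀ hη0 (by linear_combination -h3)
  rw [h5] at h4
  norm_num at h4

/-- The six-cycle has no antipodal translation from `e_0 + s e_b` except `e_0 - e_2`. -/
lemma six_translate {b α : Fin 6} (h : CycleTransferAt 6 0 b α (α + b) s t)
    (hα : α + α = 0) (h0 : α ≠ 0) (hb : 1 ≤ (b : ℕ)) (hb3 : (b : ℕ) ≤ 3)
    (hne : s ^ 2 = 1 → (b : ℕ) ≠ 3) : s = -1 ∧ (b : ℕ) = 2 := by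
  obtain ⟨e0, e1, e2, e3, e4, e5⟩ := cycleEig_six_values
  obtain ⟨η, hη, h⟩ := h.exists_phase
  have hχ := cycleChar_eq_neg_one_pow hα h0
  by_contra hcon
  by_cases hs1 : s = -1
  -- Here `b = 1`, and the eigenvalues 1, -1, -2 would carry the phases `-η`, `η`, `-η`. With `z =
  -- exp(-it)` this forces both `η = 1` and `η² = -1`.
  · subst hs1
    have hb1 : (b : ℕ) = 1 := by
      have := hne (by norm_num)
      have h2 : (b : ℕ) ≠ 2 := fun h => hcon ⟨rfl, h⟩
      omega
    have p1 := h (1 : ℕ) (one_add_cycleChar_ne_zero_of_neg_one (by rw [hb1]; norm_num))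
    have p2 := h (2 : ℕ) (one_add_cycleChar_ne_zero_of_neg_one (by rw [hb1]; norm_num))
    have p3 := h (3 : ℕ) (one_add_cycleChar_ne_zero_of_neg_one (by rw [hb1]; norm_num))
    rw [hχ] at p1 p2 p3
    push_cast at p1 p2 p3
    rw [e1] at p1
    rw [e2] at p2
    rw [e3] at p3
    have q1 := exp_neg_I_mul_ofReal_neg_one t
    have q2 := exp_neg_I_mul_ofReal_neg_two t
    rw [p1, p2] at q1
    rw [p3, p1] at q2
    have h3 : η = 1 := by linear_combination q2 - η * q1
    rw [h3] at q1
    norm_num at q1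
  -- The indices 0, 1, 2 are all in the support, so the eigenvalues 2, 1, -1 get alternating signs.
  · have hsupp : ∀ j : ℕ, j ≤ 2 → cycleChar 6 j 0 + s * cycleChar 6 j b ≠ 0 := by
      intro j hj
      by_cases hs : s ^ 2 = 1
      · have hs' : s = 1 := (mul_self_eq_one_iff.mp ((sq s).symm.trans hs)).resolve_right hs1
        subst hs'
        have hb3' := hne hs
        refine one_add_cycleChar_ne_zero_of_one fun k hk => ?_
        have hb2 : (b : ℕ) < 3 := by omega
        interval_cases hbv : (b : ℕ) <;> interval_cases j <;> push_cast at hk <;> omega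
      · exact one_add_cycleChar_ne_zero_of_sq_ne_one hs
    have p0 := h (0 : ℕ) (hsupp 0 (by norm_num))
    have p1 := h (1 : ℕ) (hsupp 1 (by norm_num))
    have p2 := h (2 : ℕ) (hsupp 2 (by norm_num))
    rw [hχ] at p0 p1 p2
    push_cast at p0 p1 p2
    rw [e0] at p0
    rw [e1] at p1
    rw [e2] at p2
    exact not_alternating_phases hη (by simpa using p0) (by simpa using p1) (by simpa using p2)

/-- A nontrivial `α` with `2α = 0` is `n/2`, so `n` is even. If `s² = 1`, then `b ≠ n/2`, since that
translation would only swap the two vertices and keep the state. -/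
lemma CycleTransferAt.exists_list_of_translate (hn : 4 ≤ n) (hb : 1 ≤ (b : ℕ))
    (hbn : 2 * (b : ℕ) ≤ n) (hs : s ≠ 0) (hα : α + α = 0)
    (h : CycleTransferAt n 0 b α (α + b) s t)
    (hne : ¬ SameState (pairState 0 b (s : ℂ)) (pairState α (α + b) (s : ℂ))) :
    ∃ τ : ℝ, CycleTransferList n b s α (α + b : Fin n) τ := by
  have ht := h.ne_zero hne
  have hα0 : α ≠ 0 := by
    rintro rfl
    rw [zero_add] at hne
    exact hne (sameState_refl _)
  have hαn := two_mul_val_of_add_self_eq_zero hα hα0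
  have hb' : s ^ 2 = 1 → 2 * (b : ℕ) ≠ n := by
    intro hs hb2
    have : b = α := Fin.ext (by omega)
    subst this
    rw [hα] at hne
    exact hne (sameState_pairState_swap _ _ hs)
  have hβ : ((α + b : Fin n) : ℕ) = ((α : ℕ) + b) % n := Fin.val_add α b
  have hsize : n = 4 ∨ n = 6 ∨ (n = 8 ∧ (b : ℕ) = 2 ∧ s = -1) := by
    by_cases hs1 : s ^ 2 = 1
    · rcases mul_self_eq_one_iff.mp ((sq s).symm.trans hs1) with rfl | rfl
      · rcases h.size_of_one ht hn hb (by have := hb' hs1; omega) with h | h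
        · exact Or.inl h
        · exact Or.inr (Or.inl h)
      · rcases h.size_of_neg_one ht hn ⟨α, by omega⟩ hb (by have := hb' hs1; omega) with
          h | h | h
        · exact Or.inl h
        · exact Or.inr (Or.inl h)
        · exact Or.inr (Or.inr ⟨h.1, h.2, rfl⟩)
    · rcases h.size_of_sq_ne_one ht hn hs1 with h | h
      · exact Or.inl h
      · exact Or.inr (Or.inl h)
  rw [hβ]
  rcases hsize with rfl | rfl | ⟨rfl, hb2, rfl⟩
  · have hα2 : (α : ℕ) = 2 := by omega
    rcases (show (b : ℕ) = 1 ∨ (b : ℕ) = 2 by omega) with hb1 | hb2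
    · exact ⟨_, Or.inl ⟨rfl, hb1, hs, hα2, by rw [hα2, hb1], rfl⟩⟩
    · refine ⟨_, Or.inr (Or.inl ⟨rfl, hb2, ?_, hs, ?_, hα2, by rw [hα2, hb2], rfl⟩)⟩
      · rintro rfl; exact hb' (by norm_num) (by omega)
      · rintro rfl; exact hb' (by norm_num) (by omega)
  · have hα3 : (α : ℕ) = 3 := by omega
    obtain ⟨hs1, hb2⟩ := six_translate h hα hα0 hb (by omega) (fun h => by
      have := hb' h; omega)
    exact ⟨_, Or.inr (Or.inr (Or.inr (Or.inl ⟨rfl, hb2, hs1, hα3, by rw [hα3, hb2], rfl⟩)))⟩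
  · have hα4 : (α : ℕ) = 4 := by omega
    exact ⟨_, Or.inr (Or.inr (Or.inr (Or.inr (Or.inr (Or.inr (Or.inl
      ⟨rfl, hb2, rfl, hα4, by rw [hα4, hb2], rfl⟩))))))⟩

/-- Here `α` is `n/4` or `3n/4`. The two choices give the same state with the vertices swapped,
which is why the conclusion allows a change of representative. -/
lemma CycleTransferAt.exists_list_of_antipodal (hn : 4 ≤ n) (hb : 1 ≤ (b : ℕ))
    (hbb : b + b = 0) (hα : α + α = b) (h : CycleTransferAt n 0 b α (α + b) 1 t)
    (hne : ¬ SameState (pairState 0 b ((1 : ℝ) : ℂ)) (pairState α (α + b) ((1 : ℝ) : ℂ))) :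
    ∃ (α' β' : Fin n) (τ : ℝ),
      SameState (pairState α (α + b) ((1 : ℝ) : ℂ)) (pairState α' β' ((1 : ℝ) : ℂ)) ∧
      CycleTransferList n b 1 α' β' τ := by
  have ht := h.ne_zero hne
  have hb0 : b ≠ 0 := by rintro rfl; simp at hb
  have hbn := two_mul_val_of_add_self_eq_zero hbb hb0
  have hαv := congrArg Fin.val hα
  rw [Fin.val_add] at hαv
  have hαlt := α.2
  have hβ : ((α + b : Fin n) : ℕ) = ((α : ℕ) + b) % n := Fin.val_add α b
  have hswap := sameState_pairState_swap (s := 1) α (α + b) (by norm_num)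
  rcases h.size_of_one_of_antipodal ht hn hbn with rfl | rfl | rfl | rfl
  · have hb2 : (b : ℕ) = 2 := by omega
    rcases (show (α : ℕ) = 1 ∨ (α : ℕ) = 3 by omega) with h1 | h3
    · exact ⟨α, α + b, _, sameState_refl _, Or.inr (Or.inr (Or.inl
        ⟨rfl, hb2, rfl, h1, by rw [hβ, h1, hb2], rfl⟩))⟩
    · exact ⟨α + b, α, _, hswap, Or.inr (Or.inr (Or.inl
        ⟨rfl, hb2, rfl, by rw [hβ, h3, hb2], h3, rfl⟩))⟩
  -- For `n = 6` the congruence `2α = 3` modulo 6 has no solution.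
  · omega
  · have hb4 : (b : ℕ) = 4 := by omega
    rcases (show (α : ℕ) = 2 ∨ (α : ℕ) = 6 by omega) with h1 | h3
    · exact ⟨α, α + b, _, sameState_refl _, Or.inr (Or.inr (Or.inr (Or.inr (Or.inr (Or.inr
        (Or.inr ⟨rfl, hb4, rfl, h1, by rw [hβ, h1, hb4], rfl⟩))))))⟩
    · exact ⟨α + b, α, _, hswap, Or.inr (Or.inr (Or.inr (Or.inr (Or.inr (Or.inr
        (Or.inr ⟨rfl, hb4, rfl, by rw [hβ, h3, hb4], h3, rfl⟩))))))⟩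
  · exfalso
    have hb6 : (b : ℕ) = 6 := by omega
    obtain ⟨e0, e2, e4⟩ := cycleEig_twelve_values
    obtain ⟨η, hη, h⟩ := h.exists_phase
    have hsupp : ∀ j : ℤ, cycleChar 12 (2 * j) 0 + ((1 : ℝ) : ℂ) * cycleChar 12 (2 * j) b ≠ 0 :=
      fun j => one_add_cycleChar_ne_zero_of_one fun k hk => by
        rw [hb6] at hk
        push_cast at hk
        omega
    have p0 := h _ (hsupp 0)
    have p1 := h _ (hsupp 1)
    have p2 := h _ (hsupp 2)
    have hχ := cycleChar_eq_neg_one_pow hbb hb0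
    -- `χ_{2j}(α) = χ_j(2α) = χ_j(b) = (-1)^j`, so the phases at the eigenvalues 2, 1, -1 would
    -- alternate.
    rw [cycleChar_two_mul, hα] at p0 p1 p2
    have c0 := hχ 0
    have c1 := hχ 1
    have c2 := hχ 2
    push_cast at c0 c1 c2
    rw [c0, mul_zero, e0] at p0
    rw [c1, mul_one, e2] at p1
    rw [c2, show (2 : ℤ) * 2 = 4 by norm_num, e4] at p2
    exact not_alternating_phases hη (by simpa using p0) (by simpa using p1) (by simpa using p2)

omit [NeZero n] in
/-- The phases at the eigenvalues `2, 1, -1` cannot have signs `+, +, -`. -/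
lemma not_phases_add_add_sub {t : ℝ} {η : ℂ} (hη : ‖η‖ = 1)
    (h0 : Complex.exp (-(Complex.I * t) * ((2 : ℝ) : ℂ)) = η)
    (h1 : Complex.exp (-(Complex.I * t) * ((1 : ℝ) : ℂ)) = η)
    (h2 : Complex.exp (-(Complex.I * t) * ((-1 : ℝ) : ℂ)) = -η) : False := by
  have hη0 : η ≠ 0 := norm_ne_zero_iff.mp (by rw [hη]; exact one_ne_zero)
  have h3 := exp_neg_I_mul_ofReal_two t
  have h4 := exp_neg_I_mul_ofReal_neg_one t
  rw [h0, h1] at h3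
  rw [h1, h2] at h4
  have h5 : η = 1 := mul_left_cancel₀ hη0 (by linear_combination -h3)
  rw [h5] at h4
  norm_num at h4

/-- The second solution `α = 3` of `2α = 0` passes the test on squares and is excluded only by the
phases: `g_j = f_j` for `j = 0, 1` but `g_2 = -f_2`. -/
lemma not_cycleTransferAt_six_two : ¬ CycleTransferAt 6 0 2 3 1 ((2 : ℝ)) t := by
  rintro ⟨η, hη, h⟩
  obtain ⟨e0, e1, e2, e3, e4, e5⟩ := cycleEig_six_values
  have hω := exp_two_pi_I_div_six_sq
  have c := cycleChar_natCast (n := 6)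
  set ω := Complex.exp (2 * Real.pi * Complex.I / (6 : ℕ))
  have h3 : ω ^ 3 = -1 := by linear_combination (ω + 1) * hω
  have h4 : ω ^ 4 = -ω := by linear_combination ω * h3
  have h6 : ω ^ 6 = 1 := by linear_combination (ω ^ 3 - 1) * h3
  have p0 := h (0 : ℕ)
  have p1 := h (1 : ℕ)
  have p2 := h (2 : ℕ)
  simp only [c] at p0 p1 p2
  push_cast at p0 p1 p2
  rw [e0] at p0
  rw [e1] at p1
  rw [e2] at p2
  simp only [Fin.isValue, Fin.coe_ofNat_eq_mod] at p0 p1 p2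
  norm_num [h3, h4, h6, hω] at p0 p1 p2
  have hne : 2 * ω - 1 ≠ 0 := by
    intro h0
    have h1 : ω = 1 / 2 := by linear_combination h0 / 2
    rw [h1] at hω; norm_num at hω
  refine not_phases_add_add_sub (t := t) hη (by push_cast; rw [neg_mul]; exact p0)
    (mul_right_cancel₀ hne ?_) (mul_right_cancel₀ hne ?_)
  · push_cast; rw [mul_one]; linear_combination p1
  · push_cast; rw [mul_neg_one, neg_neg]; linear_combination -p2

/-- The sign pattern at `j = 0, 1, 2` is the same as for `s = 2`, now for the solution `α = 1` of
`2α = 2`. -/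
lemma not_cycleTransferAt_six_half : ¬ CycleTransferAt 6 0 2 1 5 ((1 / 2 : ℝ)) t := by
  rintro ⟨η, hη, h⟩
  obtain ⟨e0, e1, e2, e3, e4, e5⟩ := cycleEig_six_values
  have hω := exp_two_pi_I_div_six_sq
  have c := cycleChar_natCast (n := 6)
  set ω := Complex.exp (2 * Real.pi * Complex.I / (6 : ℕ))
  have h3 : ω ^ 3 = -1 := by linear_combination (ω + 1) * hω
  have h4 : ω ^ 4 = -ω := by linear_combination ω * h3
  have h5 : ω ^ 5 = 1 - ω := by linear_combination ω * h4 - hω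
  have h10 : ω ^ 10 = -ω := by linear_combination h4 + ω ^ 4 * (ω ^ 3 - 1) * h3
  have p0 := h (0 : ℕ)
  have p1 := h (1 : ℕ)
  have p2 := h (2 : ℕ)
  simp only [c] at p0 p1 p2
  push_cast at p0 p1 p2
  rw [e0] at p0
  rw [e1] at p1
  rw [e2] at p2
  simp only [Fin.isValue, Fin.coe_ofNat_eq_mod] at p0 p1 p2
  norm_num [h10, h4, h5, hω] at p0 p1 p2
  have hne : ω + 1 ≠ 0 := by
    intro h0
    have h1 : ω = -1 := by linear_combination h0
    rw [h1] at hω; norm_num at hω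
  have hne2 : ω - 2 ≠ 0 := by
    intro h0
    have h1 : ω = 2 := by linear_combination h0
    rw [h1] at hω; norm_num at hω
  refine not_phases_add_add_sub (t := t) hη (by push_cast; rw [neg_mul]; exact p0)
    (mul_right_cancel₀ hne ?_) (mul_right_cancel₀ hne2 ?_)
  · push_cast; rw [mul_one]; linear_combination 2 * p1
  · push_cast; rw [mul_neg_one, neg_neg]; linear_combination -2 * p2

lemma CycleTransferAt.exists_list (hn : 4 ≤ n) (hb : 1 ≤ (b : ℕ)) (hbn : 2 * (b : ℕ) ≤ n)
    (hs : s ≠ 0) (h : CycleTransferAt n 0 b α β s t)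
    (hne : ¬ SameState (pairState 0 b (s : ℂ)) (pairState α β (s : ℂ))) :
    ∃ (α' β' : Fin n) (τ : ℝ),
      SameState (pairState α β (s : ℂ)) (pairState α' β' (s : ℂ)) ∧
      CycleTransferList n b s α' β' τ := by
  have ht := h.ne_zero hne
  have hb0 : b ≠ 0 := by rintro rfl; simp at hb
  have hbv : ∀ m, n = m → b + b + b = 0 → (((b : ℕ) + b) % m + b) % m = 0 := by
    rintro m rfl h3
    have := congrArg Fin.val h3
    rwa [Fin.val_add, Fin.val_add, Fin.val_zero] at this
  rcases h.final_state hb0 hs with ⟨rfl, hα | ⟨hbb, hα, rfl⟩⟩ | ⟨hα, hs2, hβ⟩ |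
    ⟨hα, rfl, hbbb, hαα⟩ | ⟨hα, rfl, hbbb, hαα⟩
  · obtain ⟨τ, hτ⟩ := h.exists_list_of_translate hn hb hbn hs hα hne
    exact ⟨_, _, τ, sameState_refl _, hτ⟩
  · exact h.exists_list_of_antipodal hn hb hbb hα hne
  · have hswap := sameState_pairState_swap α β hs2
    subst hα
    -- For `s² = 1` swapping the final pair changes only the phase, so the reflected case is again a
    -- translation.
    have h' : CycleTransferAt n 0 b β (β + b) s t := by
      have := (stateTransferAt_cycle_iff (by omega) (Or.inl rfl) 0 b (β + b) β s t).mpr h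
      exact (stateTransferAt_cycle_iff (by omega) (Or.inl rfl) 0 b β (β + b) s t).mp
        (this.congr_right hswap)
    obtain ⟨τ, hτ⟩ := h'.exists_list_of_translate hn hb hbn hs hβ
      (fun h => hne (h.trans hswap.symm))
    exact ⟨_, _, τ, hswap, hτ⟩
  · rcases h.size_of_sq_ne_one ht hn (by norm_num) with rfl | rfl
    · have := hbv 4 rfl hbbb
      omega
    · have := hbv 6 rfl hbbb
      obtain rfl : b = 2 := Fin.ext (by simp; omega)
      have hβ : β = α - 2 := by rw [hα, add_sub_cancel_right]
      subst hβ
      have h5 := congrArg Fin.val hαα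
      change ((α : ℕ) + α) % 6 = 0 at h5
      have hα6 := α.2
      rcases (show (α : ℕ) = 0 ∨ (α : ℕ) = 3 by omega) with h6 | h6
      · obtain rfl : α = 0 := Fin.ext h6
        exact ⟨0, 4, _, sameState_refl _, Or.inr (Or.inr (Or.inr (Or.inr (Or.inl
          ⟨rfl, rfl, rfl, rfl, rfl, rfl⟩))))⟩
      · obtain rfl : α = 3 := Fin.ext h6
        exact absurd h not_cycleTransferAt_six_two
  · rcases h.size_of_sq_ne_one ht hn (by norm_num) with rfl | rfl
    · have := hbv 4 rfl hbbb
      omega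
    · have := hbv 6 rfl hbbb
      obtain rfl : b = 2 := Fin.ext (by simp; omega)
      have hβ : β = α - 2 := by rw [hα, add_sub_cancel_right]
      subst hβ
      have h5 := congrArg Fin.val hαα
      change ((α : ℕ) + α) % 6 = 2 at h5
      have hα6 := α.2
      rcases (show (α : ℕ) = 1 ∨ (α : ℕ) = 4 by omega) with h6 | h6
      · obtain rfl : α = 1 := Fin.ext h6
        exact absurd h not_cycleTransferAt_six_half
      · obtain rfl : α = 4 := Fin.ext h6
        exact ⟨4, 2, _, sameState_refl _, Or.inr (Or.inr (Or.inr (Or.inr (Or.inr (Or.inl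
          ⟨rfl, rfl, rfl, rfl, rfl, rfl⟩)))))⟩

end Classification

/-! ### The listed final states are genuinely different and reached in the listed time -/

section Converse

variable {n : ℕ} [NeZero n] {s : ℝ} {b α β : Fin n}

omit [NeZero n] in
lemma not_sameState_pairState_of_left {a b α β : Fin n} (hab : a ≠ b) (hα : a ≠ α) (hβ : a ≠ β) :
    ¬ SameState (pairState a b (s : ℂ)) (pairState α β (s : ℂ)) := by
  rw [sameState_pairState_iff]
  rintro ⟨η, -, h⟩
  simpa [hab, hα, hβ] using h a

omit [NeZero n] in
lemma not_sameState_pairState_of_right {a b α β : Fin n} (hs : s ≠ 0) (hab : b ≠ a) (hα : b ≠ α)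
    (hβ : b ≠ β) : ¬ SameState (pairState a b (s : ℂ)) (pairState α β (s : ℂ)) := by
  rw [sameState_pairState_iff]
  rintro ⟨η, -, h⟩
  have := h b
  simp [hab, hα, hβ, hs] at this

omit [NeZero n] in
lemma not_sameState_pairState_swap {a b : Fin n} (hab : a ≠ b) (h1 : s ≠ 1) (h2 : s ≠ -1) :
    ¬ SameState (pairState a b (s : ℂ)) (pairState b a (s : ℂ)) := by
  rw [sameState_pairState_iff]
  rintro ⟨η, hη, h⟩
  have h3 := congrArg norm (h a)
  simp only [if_pos, if_neg hab, mul_zero, add_zero, zero_add, norm_one, mul_one, norm_mul, hη,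
    one_mul, Complex.norm_real, Real.norm_eq_abs] at h3
  rcases (abs_eq (zero_le_one (α := ℝ))).mp h3.symm with h | h
  · exact h1 h
  · exact h2 h

lemma CycleTransferList.transfer {τ : ℝ} (h : CycleTransferList n b s α β τ) :
    (¬ SameState (pairState 0 b (s : ℂ)) (pairState α β (s : ℂ))) ∧
      IsLeast {t : ℝ | 0 < t ∧ CycleTransferAt n 0 b α β s t} τ := by
  have hπ := Real.pi_pos
  rcases h with ⟨rfl, hb, hs, hα, hβ, rfl⟩ | ⟨rfl, hb, hs1, hs, hs2, hα, hβ, rfl⟩ |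
    ⟨rfl, hb, rfl, hα, hβ, rfl⟩ | ⟨rfl, hb, rfl, hα, hβ, rfl⟩ | ⟨rfl, hb, rfl, hα, hβ, rfl⟩ |
    ⟨rfl, hb, rfl, hα, hβ, rfl⟩ | ⟨rfl, hb, rfl, hα, hβ, rfl⟩ | ⟨rfl, hb, rfl, hα, hβ, rfl⟩
  · obtain rfl : b = 1 := Fin.ext hb
    obtain rfl : α = 2 := Fin.ext hα
    obtain rfl : β = 3 := Fin.ext hβ
    exact ⟨not_sameState_pairState_of_left (Fin.ne_of_val_ne (by simp)) (Fin.ne_of_val_ne (by simp)) (Fin.ne_of_val_ne (by simp)),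
      ⟨by positivity, cycleTransferAt_four_adjacent⟩, fun t ht => ht.2.le_four_adjacent ht.1⟩
  · obtain rfl : b = 2 := Fin.ext hb
    obtain rfl : α = 2 := Fin.ext hα
    obtain rfl : β = 0 := Fin.ext hβ
    exact ⟨not_sameState_pairState_swap (Fin.ne_of_val_ne (by simp)) hs2 hs1,
      ⟨by positivity, cycleTransferAt_four_swap⟩, fun t ht => ht.2.le_four_swap hs1 hs2 ht.1⟩
  · obtain rfl : b = 2 := Fin.ext hb
    obtain rfl : α = 1 := Fin.ext hα
    obtain rfl : β = 3 := Fin.ext hβ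
    exact ⟨not_sameState_pairState_of_left (Fin.ne_of_val_ne (by simp)) (Fin.ne_of_val_ne (by simp)) (Fin.ne_of_val_ne (by simp)),
      ⟨by positivity, cycleTransferAt_four_antipodal⟩, fun t ht => ht.2.le_four_antipodal ht.1⟩
  · obtain rfl : b = 2 := Fin.ext hb
    obtain rfl : α = 3 := Fin.ext hα
    obtain rfl : β = 5 := Fin.ext hβ
    exact ⟨not_sameState_pairState_of_left (Fin.ne_of_val_ne (by simp)) (Fin.ne_of_val_ne (by simp)) (Fin.ne_of_val_ne (by simp)),
      ⟨by positivity, cycleTransferAt_six_neg_one⟩, fun t ht => ht.2.le_six_neg_one ht.1⟩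
  · obtain rfl : b = 2 := Fin.ext hb
    obtain rfl : α = 0 := Fin.ext hα
    obtain rfl : β = 4 := Fin.ext hβ
    exact ⟨not_sameState_pairState_of_right two_ne_zero (Fin.ne_of_val_ne (by simp)) (Fin.ne_of_val_ne (by simp)) (Fin.ne_of_val_ne (by simp)),
      ⟨by positivity, cycleTransferAt_six_two⟩, fun t ht => ht.2.le_six_two ht.1⟩
  · obtain rfl : b = 2 := Fin.ext hb
    obtain rfl : α = 4 := Fin.ext hα
    obtain rfl : β = 2 := Fin.ext hβ
    exact ⟨not_sameState_pairState_of_left (Fin.ne_of_val_ne (by simp)) (Fin.ne_of_val_ne (by simp)) (Fin.ne_of_val_ne (by simp)),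
      ⟨by positivity, cycleTransferAt_six_half⟩, fun t ht => ht.2.le_six_half ht.1⟩
  · obtain rfl : b = 2 := Fin.ext hb
    obtain rfl : α = 4 := Fin.ext hα
    obtain rfl : β = 6 := Fin.ext hβ
    exact ⟨not_sameState_pairState_of_left (Fin.ne_of_val_ne (by simp)) (Fin.ne_of_val_ne (by simp)) (Fin.ne_of_val_ne (by simp)),
      ⟨by positivity, cycleTransferAt_eight_neg_one⟩, fun t ht => ht.2.le_eight_neg_one ht.1⟩
  · obtain rfl : b = 4 := Fin.ext hb
    obtain rfl : α = 2 := Fin.ext hα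
    obtain rfl : β = 6 := Fin.ext hβ
    exact ⟨not_sameState_pairState_of_left (Fin.ne_of_val_ne (by simp)) (Fin.ne_of_val_ne (by simp)) (Fin.ne_of_val_ne (by simp)),
      ⟨by positivity, cycleTransferAt_eight_antipodal⟩, fun t ht => ht.2.le_eight_antipodal ht.1⟩

end Converse

/-! ### The classification -/

theorem mainTheorem1 (n : ℕ) [NeZero n] (hn : 4 ≤ n)
    (M : Matrix (Fin n) (Fin n) ℝ)
    (hM : M = (SimpleGraph.cycleGraph n).adjMatrix ℝ ∨
      M = (SimpleGraph.cycleGraph n).lapMatrix ℝ ∨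
      M = signlessLapMatrix (SimpleGraph.cycleGraph n))
    (b : Fin n) (hb : 1 ≤ (b : ℕ)) (hbn : 2 * (b : ℕ) ≤ n)
    (s : ℝ) (hs : s ≠ 0) :
    (∀ α β : Fin n, α ≠ β →
      (PerfectStateTransfer M (pairState 0 b (s : ℂ)) (pairState α β (s : ℂ)) ↔
        ∃ (α' β' : Fin n) (τ : ℝ),
          SameState (pairState α β (s : ℂ)) (pairState α' β' (s : ℂ)) ∧
          CycleTransferList n b s α' β' τ)) ∧
    (∀ (α β : Fin n) (τ : ℝ), CycleTransferList n b s α β τ →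
      PerfectStateTransfer M (pairState 0 b (s : ℂ)) (pairState α β (s : ℂ)) ∧
      IsMinTransferTime M (pairState 0 b (s : ℂ)) (pairState α β (s : ℂ)) τ) := by
  have key := fun α β t => stateTransferAt_cycle_iff (by omega) hM 0 b α β s t
  have hlist : ∀ (α β : Fin n) (τ : ℝ), CycleTransferList n b s α β τ →
      PerfectStateTransfer M (pairState 0 b (s : ℂ)) (pairState α β (s : ℂ)) ∧
      IsMinTransferTime M (pairState 0 b (s : ℂ)) (pairState α β (s : ℂ)) τ := by
    intro α β τ h
    obtain ⟨h1, h2⟩ := h.transfer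
    refine ⟨⟨h1, τ, (key α β τ).mpr h2.1.2⟩, ?_⟩
    unfold IsMinTransferTime
    simpa only [key] using h2
  refine ⟨fun α β _ => ⟨?_, ?_⟩, hlist⟩
  · rintro ⟨h1, t, h2⟩
    exact ((key α β t).mp h2).exists_list hn hb hbn hs h1
  · rintro ⟨α', β', τ, h1, h2⟩
    exact (hlist α' β' τ h2).1.congr_right h1.symm
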